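/- Let $G$ be a finite connected simple graph with $n$ vertices $v_1,\dots,v_n$ and $m$ edges $e_1,\dots,e_m$, all of whose vertices have degree at least $2$, each edge $e_j$ being parameterized over $[0,1]$. Let $\Phi^+=(\phi^+_{ij})$ and $\Phi^-=(\phi^-_{ij})$ be the $n\times m$ matrices with $\phi^+_{ij}=1$ if $e_j(0)=v_i$ and $0$ otherwise, and $\phi^-_{ij}=1$ if $e_j(1)=v_i$ and $0$ otherwise. Let $\mu_1,\dots,\mu_m>0$ be constants, $M=\mathrm{diag}(\mu_1,\dots,\mu_m)$, and $\Phi_w^{\pm}=\Phi^{\pm}M$. On the complex Hilbert space $X_2=\prod_{j=1}^m L^2(0,1;\mu_j\,dx)$ consider the operator $Af=(f_1'',\dots,f_m'')$ with domain $$D(A)=\Big\{f\in \big(H^2(0,1)\big)^m:\ \Phi_w^+f'(0)=\Phi_w^-f'(1)\ \text{ and }\ \exists d\in\mathbb C^n:\ (\Phi^+)^\top d=f(0),\ (\Phi^-)^\top d=f(1)\Big\}$$ (the case $c_j=1$ of the diffusion operator on the network). Let $P=D_\mu^{-1}\mathbb A_\mu$, where $\mathbb A_\mu$ is the symmetric $n\times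 n$ matrix whose $(i,k)$ entry is $\mu_j$ if $e_j$ joins $v_i$ and $v_k$, and $0$ if $v_i,v_k$ are not adjacent, and $D_\mu$ is the diagonal matrix with $i$-th entry $\sum_{e_j\ni v_i}\mu_j$. If all $\mu_j$ are equal (in particular if $\mu_j=1$ for all $j$), then $P=D^{-1}\mathbb A$ is the usual transition matrix of $G$, where $\mathbb A$ is the $0$-$1$ adjacency matrix and $D$ the diagonal matrix of vertex degrees. Put $$\sigma_p=\{-(2l\pi\pm\arccos\alpha)^2:\ \alpha\in\sigma(P)\setminus\{-1,1\},\ l\in\mathbb Z\},\qquad \sigma_k=\{-k^2\pi^2:\ k\in\mathbb Z\setminus\{0\}\}.$$ If $G$ is bipartite or $m\neq n$ (that is, unless $G$ is an odd cycle), then $$\sigma(A)=\{0\}\cup\sigma_p\cup\sigma_k .$$ If $G$ is not bipartite and $m=n$ (that is, if $G$ is an odd cycle), then $\sigma(A)=\{0\}\cup\sigma_p\cup\{-4l^2\pi^2: l\in\mathbb Z\setminus\{0\}\}$. For every $z\in\mathbb C$ the algebraic and the geometric multiplicity of $z$ as an eigenvalue of $A$ coincide (both being $0$ if $z$ is not an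 eigenvalue). Writing $m(z)$ for their common value, 1. $m(0)=1$; 2. $m(-\lambda)=\dim\ker(\cos\sqrt\lambda\cdot I-P)$ for all $-\lambda\in\sigma_p$; 3. if $G$ is bipartite, $m(-k^2\pi^2)=m-n+2$ for all $k\in\mathbb Z\setminus\{0\}$; 4. if $G$ is not bipartite, $m(-4l^2\pi^2)=m-n+2$ for all $l\in\mathbb Z\setminus\{0\}$ and $m(-(2l+1)^2\pi^2)=m-n$ for all $l\in\mathbb Z$. -/

import Mathlib

open MeasureTheory Set
open scoped ContDiff Matrix

noncomputable section

/-! ### Unbounded operators: spectrum, eigenspaces, multiplicities -/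

namespace UnboundedOp

variable {H : Type*} [NormedAddCommGroup H] [NormedSpace ℂ H]

/-- `z` is in the resolvent set of `A` if `z - A : D(A) → H` is a bijection with bounded inverse. -/
def resolventSet (A : H →ₗ.[ℂ] H) : Set ℂ :=
  {z | ∃ R : H →L[ℂ] H,
    (∀ g : H, ∃ h : R g ∈ A.domain, z • R g - A ⟨R g, h⟩ = g) ∧
    ∀ f : A.domain, R (z • (f : H) - A f) = f}

/-- The spectrum of an unbounded operator. -/
def spectrum (A : H →ₗ.[ℂ] H) : Set ℂ := (resolventSet A)ᶜ

/-- `genKer A z k` is the kernel of `(A - z) ^ k` on its natural domain. -/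
def genKer (A : H →ₗ.[ℂ] H) (z : ℂ) : ℕ → Submodule ℂ H
  | 0 => ⊥
  | k + 1 => ((genKer A z k).comap (A.toFun - z • A.domain.subtype)).map A.domain.subtype

/-- The eigenspace `{f ∈ D(A) : A f = z f}`. -/
def eigenspace (A : H →ₗ.[ℂ] H) (z : ℂ) : Submodule ℂ H :=
  (LinearMap.ker (A.toFun - z • A.domain.subtype)).map A.domain.subtype

/-- Geometric multiplicity of `z` (it is `0` if `z` is not an eigenvalue). -/
def geomMult (A : H →ₗ.[ℂ] H) (z : ℂ) : ℕ∞ :=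
  (Module.rank ℂ (eigenspace A z)).toENat

/-- Algebraic multiplicity of `z`: dimension of the space of generalized eigenvectors. -/
def algMult (A : H →ₗ.[ℂ] H) (z : ℂ) : ℕ∞ :=
  (Module.rank ℂ (⨆ k, genKer A z k : Submodule ℂ H)).toENat

theorem mem_eigenspace (A : H →ₗ.[ℂ] H) (z : ℂ) (f : H) :
    f ∈ eigenspace A z ↔ ∃ h : f ∈ A.domain, A ⟨f, h⟩ = z • f := by
  simp only [eigenspace, Submodule.mem_map, LinearMap.mem_ker, Submodule.subtype_apply]
  constructor
  · rintro ⟨x, hx, rfl⟩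
    exact ⟨x.2, sub_eq_zero.mp hx⟩
  · rintro ⟨h, hf⟩
    exact ⟨⟨f, h⟩, sub_eq_zero.mpr hf, rfl⟩

end UnboundedOp

/-! ### Weak derivatives on the interval `(0,1)` -/

/-- `g` is the weak derivative of `f` on `(0,1)`. -/
structure IsWeakDeriv (f g : ℝ → ℂ) : Prop where
  integrable_left : IntegrableOn f (Ioo 0 1)
  integrable_right : IntegrableOn g (Ioo 0 1)
  integral_eq : ∀ φ : ℝ → ℝ, ContDiff ℝ ∞ φ → HasCompactSupport φ → tsupport φ ⊆ Ioo 0 1 →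
    ∫ x in Ioo (0 : ℝ) 1, deriv φ x • f x = -∫ x in Ioo (0 : ℝ) 1, φ x • g x

/-- `u` is the continuous representative on `[0,1]` of an element of the Sobolev space `H²(0,1)`,
`v` is the continuous representative of its weak derivative,
and `w ∈ L²(0,1)` is its second weak derivative. -/
structure IsH2 (u v w : ℝ → ℂ) : Prop where
  cont_left : ContinuousOn u (Icc 0 1)
  cont_right : ContinuousOn v (Icc 0 1)
  memLp : MemLp w 2 (volume.restrict (Ioo 0 1))
  weak_fst : IsWeakDeriv u v
  weak_snd : IsWeakDeriv v w

theorem IsWeakDeriv.integrable_smul {h : ℝ → ℂ} (hh : IntegrableOn h (Ioo 0 1)) {φ : ℝ → ℝ}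
    (hφ : Continuous φ) (hs : HasCompactSupport φ) :
    Integrable (fun x => φ x • h x) (volume.restrict (Ioo 0 1)) := by
  obtain ⟨C, hC⟩ := hs.exists_bound_of_continuous hφ
  exact Integrable.bdd_smul hh C hφ.aestronglyMeasurable (Filter.Eventually.of_forall hC)

theorem IsWeakDeriv.add {f g f' g' : ℝ → ℂ} (h : IsWeakDeriv f g) (h' : IsWeakDeriv f' g') :
    IsWeakDeriv (f + f') (g + g') where
  integrable_left := h.integrable_left.add h'.integrable_left
  integrable_right := h.integrable_right.add h'.integrable_right
  integral_eq φ hφ hs ht := by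
    have hd : Continuous (deriv φ) := hφ.continuous_deriv (by simp)
    simp only [Pi.add_apply, smul_add]
    rw [integral_add (integrable_smul h.integrable_left hd hs.deriv)
        (integrable_smul h'.integrable_left hd hs.deriv),
      integral_add (integrable_smul h.integrable_right hφ.continuous hs)
        (integrable_smul h'.integrable_right hφ.continuous hs),
      h.integral_eq φ hφ hs ht, h'.integral_eq φ hφ hs ht, neg_add]

theorem IsWeakDeriv.const_smul {f g : ℝ → ℂ} (a : ℂ) (h : IsWeakDeriv f g) :
    IsWeakDeriv (a • f) (a • g) where
  integrable_left := h.integrable_left.smul a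
  integrable_right := h.integrable_right.smul a
  integral_eq φ hφ hs ht := by
    simp only [Pi.smul_apply]
    simp_rw [smul_comm _ a]
    rw [integral_smul, integral_smul, h.integral_eq φ hφ hs ht, smul_neg]

theorem IsWeakDeriv.zero : IsWeakDeriv 0 0 where
  integrable_left := integrableOn_zero
  integrable_right := integrableOn_zero
  integral_eq φ _ _ _ := by simp

/-- Weak derivatives are unique. -/
theorem IsWeakDeriv.ae_eq_zero {f g : ℝ → ℂ} (h : IsWeakDeriv f g)
    (hf : f =ᵐ[volume.restrict (Ioo 0 1)] 0) : g =ᵐ[volume.restrict (Ioo 0 1)] 0 := by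
  have key := isOpen_Ioo.ae_eq_zero_of_integral_contDiff_smul_eq_zero (μ := volume)
    (U := Ioo (0 : ℝ) 1) (f := g) h.integrable_right.locallyIntegrableOn ?_
  · exact (ae_restrict_iff' measurableSet_Ioo).2 key
  · intro φ hφ hs ht
    have h0 := h.integral_eq φ hφ hs ht
    have h1 : ∫ x in Ioo (0 : ℝ) 1, deriv φ x • f x = 0 :=
      integral_eq_zero_of_ae (by filter_upwards [hf] with x hx; simp [hx])
    rw [h1, zero_eq_neg] at h0
    rw [← h0, setIntegral_eq_integral_of_forall_compl_eq_zero]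
    intro x hx
    rw [image_eq_zero_of_notMem_tsupport (fun hx' => hx (ht hx')), zero_smul]

theorem IsH2.add {u v w u' v' w' : ℝ → ℂ} (h : IsH2 u v w) (h' : IsH2 u' v' w') :
    IsH2 (u + u') (v + v') (w + w') :=
  ⟨h.cont_left.add h'.cont_left, h.cont_right.add h'.cont_right, h.memLp.add h'.memLp,
    h.weak_fst.add h'.weak_fst, h.weak_snd.add h'.weak_snd⟩

theorem IsH2.const_smul {u v w : ℝ → ℂ} (a : ℂ) (h : IsH2 u v w) :
    IsH2 (a • u) (a • v) (a • w) :=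
  ⟨h.cont_left.const_smul a, h.cont_right.const_smul a, h.memLp.const_smul a,
    h.weak_fst.const_smul a, h.weak_snd.const_smul a⟩

theorem IsH2.zero : IsH2 0 0 0 :=
  ⟨continuousOn_const, continuousOn_const, MemLp.zero, IsWeakDeriv.zero, IsWeakDeriv.zero⟩

/-! ### Networks -/

/-- A parameterization of every edge of `G` over `[0,1]`:
`zero e` and `one e` are the endpoints `e(0)` and `e(1)` of the edge `e`. -/
structure EdgeParam {V : Type*} (G : SimpleGraph V) where
  zero : G.edgeSet → V
  one : G.edgeSet → V
  ends : ∀ e : G.edgeSet, s(zero e, one e) = (e : Sym2 V)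

namespace EdgeParam

variable {V : Type*} [DecidableEq V] {G : SimpleGraph V} (o : EdgeParam G)

/-- The matrix `Φ⁺`. -/
def incPlus : Matrix V G.edgeSet ℂ := fun i e => if o.zero e = i then 1 else 0

/-- The matrix `Φ⁻`. -/
def incMinus : Matrix V G.edgeSet ℂ := fun i e => if o.one e = i then 1 else 0

/-- The weighted matrix `Φ_w⁺`, for constant coefficients `c`. -/
def wIncPlus (c μ : G.edgeSet → ℝ) : Matrix V G.edgeSet ℂ :=
  fun i e => if o.zero e = i then ((μ e * c e : ℝ) : ℂ) else 0

/-- The weighted matrix `Φ_w⁻`, for constant coefficients `c`. -/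
def wIncMinus (c μ : G.edgeSet → ℝ) : Matrix V G.edgeSet ℂ :=
  fun i e => if o.one e = i then ((μ e * c e : ℝ) : ℂ) else 0

end EdgeParam

/-- The measure `μ dx` on `(0,1)`. -/
abbrev edgeMeasure (μ : ℝ) : Measure ℝ := ENNReal.ofReal μ • volume.restrict (Ioo 0 1)

/-- The Hilbert space `X₂ = ∏ L²(0,1; μ_j dx)`. -/
abbrev X2 {E : Type*} (μ : E → ℝ) : Type _ := PiLp 2 (fun e => Lp ℂ 2 (edgeMeasure (μ e)))

section Operator

variable {V : Type*} [Fintype V] [DecidableEq V] {G : SimpleGraph V} [Fintype G.edgeSet]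

/-- The graph `{(f, A f) : f ∈ D(A)}` of the network operator with constant coefficients `c`:
`f ∈ H²` on every edge, `Φ_w⁺ f'(0) = Φ_w⁻ f'(1)`, there is `d` with `(Φ⁺)ᵀ d = f(0)` and
`(Φ⁻)ᵀ d = f(1)`, and `(A f)_e = c_e f_e''`. -/
def networkGraph (o : EdgeParam G) (c μ : G.edgeSet → ℝ) : Submodule ℂ (X2 μ × X2 μ) where
  carrier := {p | ∃ u v w : G.edgeSet → ℝ → ℂ,
    (∀ e, IsH2 (u e) (v e) (w e)) ∧
    (∀ e, p.1 e =ᵐ[edgeMeasure (μ e)] u e) ∧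
    (∀ e, p.2 e =ᵐ[edgeMeasure (μ e)] ((c e : ℂ) • w e)) ∧
    o.wIncPlus c μ *ᵥ (fun e => v e 0) = o.wIncMinus c μ *ᵥ (fun e => v e 1) ∧
    ∃ d : V → ℂ, o.incPlusᵀ *ᵥ d = (fun e => u e 0) ∧ o.incMinusᵀ *ᵥ d = (fun e => u e 1)}
  zero_mem' := by
    refine ⟨0, 0, 0, fun e => IsH2.zero, fun e => Lp.coeFn_zero .., fun e => ?_, ?_, 0, ?_, ?_⟩
    · filter_upwards [Lp.coeFn_zero ℂ 2 (edgeMeasure (μ e))] with x hx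
      simpa using hx
    · simp only [Pi.zero_apply]
      exact (Matrix.mulVec_zero _).trans (Matrix.mulVec_zero _).symm
    · ext; simp
    · ext; simp
  add_mem' := by
    rintro p q ⟨u, v, w, h, h1, h2, hk, d, hd0, hd1⟩ ⟨u', v', w', h', h1', h2', hk', d', hd0', hd1'⟩
    refine ⟨u + u', v + v', w + w', fun e => (h e).add (h' e), fun e => ?_, fun e => ?_, ?_,
      d + d', ?_, ?_⟩
    · filter_upwards [h1 e, h1' e, Lp.coeFn_add (p.1 e) (q.1 e)] with x a b c
      simp only [Prod.fst_add, PiLp.add_apply, Pi.add_apply] at c ⊢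
      rw [c, a, b]
    · filter_upwards [h2 e, h2' e, Lp.coeFn_add (p.2 e) (q.2 e)] with x a b c
      simp only [Prod.snd_add, PiLp.add_apply, Pi.add_apply, Pi.smul_apply, smul_add] at a b c ⊢
      rw [c, a, b]
    · have := congrArg₂ (· + ·) hk hk'
      simp only [← Matrix.mulVec_add] at this
      exact this
    · rw [Matrix.mulVec_add, hd0, hd0']; rfl
    · rw [Matrix.mulVec_add, hd1, hd1']; rfl
  smul_mem' := by
    rintro a p ⟨u, v, w, h, h1, h2, hk, d, hd0, hd1⟩
    refine ⟨a • u, a • v, a • w, fun e => (h e).const_smul a, fun e => ?_, fun e => ?_, ?_,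
      a • d, ?_, ?_⟩
    · filter_upwards [h1 e, Lp.coeFn_smul a (p.1 e)] with x hx c
      simp only [Prod.smul_fst, PiLp.smul_apply, Pi.smul_apply] at c ⊢
      rw [c, hx]
    · filter_upwards [h2 e, Lp.coeFn_smul a (p.2 e)] with x hx c
      simp only [Prod.smul_snd, PiLp.smul_apply, Pi.smul_apply] at hx c ⊢
      rw [c, hx, smul_comm]
    · have := congrArg (a • ·) hk
      simp only [← Matrix.mulVec_smul] at this
      exact this
    · rw [Matrix.mulVec_smul, hd0]; rfl
    · rw [Matrix.mulVec_smul, hd1]; rfl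

theorem networkGraph_single_valued (o : EdgeParam G) (c μ : G.edgeSet → ℝ) (p : X2 μ × X2 μ)
    (hp : p ∈ networkGraph o c μ) (h0 : p.1 = 0) : p.2 = 0 := by
  obtain ⟨u, v, w, h, h1, h2, -, -⟩ := hp
  ext e : 1
  refine Lp.ext ?_
  have hz : (w e) =ᵐ[edgeMeasure (μ e)] 0 := by
    rcases le_or_gt (μ e) 0 with hμ | hμ
    · rw [edgeMeasure, ENNReal.ofReal_of_nonpos hμ, zero_smul, ae_zero]
      exact Filter.eventually_bot
    · have hne : ENNReal.ofReal (μ e) ≠ 0 := by simpa using hμ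
      have hu : u e =ᵐ[edgeMeasure (μ e)] 0 := by
        filter_upwards [h1 e, Lp.coeFn_zero ℂ 2 (edgeMeasure (μ e))] with x a b
        rw [← a, h0]
        exact b
      have hu' : u e =ᵐ[volume.restrict (Ioo 0 1)] 0 := by
        rwa [Filter.EventuallyEq, Measure.ae_ennreal_smul_measure_iff hne] at hu
      rw [Filter.EventuallyEq, Measure.ae_ennreal_smul_measure_iff hne]
      exact ((h e).weak_snd.ae_eq_zero ((h e).weak_fst.ae_eq_zero hu'))
  filter_upwards [h2 e, hz, Lp.coeFn_zero ℂ 2 (edgeMeasure (μ e))] with x a b c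
  rw [a]
  simp only [PiLp.zero_apply]
  rw [c]
  simp [b]

/-- The operator `(A, D(A))` on `X₂`. -/
def networkOperator (o : EdgeParam G) (c μ : G.edgeSet → ℝ) : X2 μ →ₗ.[ℂ] X2 μ :=
  (networkGraph o c μ).toLinearPMap

/-- `f ∈ D(A)` and `A f = g` precisely when `(f, g)` belongs to `networkGraph`. -/
theorem networkOperator_graph (o : EdgeParam G) (c μ : G.edgeSet → ℝ) :
    (networkOperator o c μ).graph = networkGraph o c μ :=
  Submodule.toLinearPMap_graph_eq _ (networkGraph_single_valued o c μ)

end Operator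

/-! ### Transition matrices -/

section Transition

variable {V : Type*} [Fintype V] [DecidableEq V] (G : SimpleGraph V) [DecidableRel G.Adj]

/-- Adjacency matrix in which the edge `e` has weight `μ e`. -/
def wAdjMatrix (μ : G.edgeSet → ℝ) : Matrix V V ℝ :=
  fun i k => if h : G.Adj i k then μ ⟨s(i, k), h⟩ else 0

/-- Diagonal matrix of weighted vertex degrees. -/
def wDegMatrix (μ : G.edgeSet → ℝ) : Matrix V V ℝ :=
  Matrix.diagonal fun i => ∑ e : G.edgeSet, if i ∈ (e : Sym2 V) then μ e else 0

/-- Transition matrix of the graph with edge weights `μ`. -/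
def wTransitionMatrix (μ : G.edgeSet → ℝ) : Matrix V V ℝ :=
  (wDegMatrix G μ)⁻¹ * wAdjMatrix G μ

/-- The transition matrix `D⁻¹ 𝔸` of the graph. -/
def transitionMatrix : Matrix V V ℝ := (G.degMatrix ℝ)⁻¹ * G.adjMatrix ℝ

end Transition

/-- The set of all `-(2lπ ± arccos α)²` with `α ∈ σ(P) \ {-1, 1}` and `l ∈ ℤ`. -/
def sigmaP {V : Type*} [Fintype V] [DecidableEq V] (P : Matrix V V ℝ) : Set ℂ :=
  {z | ∃ α ∈ _root_.spectrum ℝ P \ {-1, 1}, ∃ l : ℤ,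
    z = ((-(2 * l * Real.pi + Real.arccos α) ^ 2 : ℝ) : ℂ) ∨
    z = ((-(2 * l * Real.pi - Real.arccos α) ^ 2 : ℝ) : ℂ)}

/-- The set of all `-k²π²` with `k ∈ ℤ \ {0}`. -/
def sigmaK : Set ℂ :=
  {z | ∃ k : ℤ, k ≠ 0 ∧ z = ((-(k ^ 2 * Real.pi ^ 2) : ℝ) : ℂ)}

/-- The set of all `-4l²π²` with `l ∈ ℤ \ {0}`. -/
def sigmaEven : Set ℂ :=
  {z | ∃ l : ℤ, l ≠ 0 ∧ z = ((-(4 * l ^ 2 * Real.pi ^ 2) : ℝ) : ℂ)}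

end

/-! ### Primitives on `[0,1]` -/

/-! On each edge an eigenfunction for `z` solves `u'' = z u`, so it is `d(e(0)) C + b_e S` for a
fundamental pair `C`, `S`. Vertex values `d` and initial slopes `b` determine it, and the boundary
conditions become a square linear system of size `n + m` whose kernel is the eigenspace
(`nonempty_eigenspace_equiv`).

Write `z = -w²`, so that `C(1) = cos w` and `w S(1) = sin w`. If `S(1) ≠ 0`, the slopes can be
eliminated; by `C² - z S² = 1`, Kirchhoff's law turns into `P d = cos w · d`
(`finrank_ker_vertexSystem_of_ne_zero`). If `S(1) = 0`, then `ε = cos w = ±1` and the system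
decouples: `d` lies in the kernel of the signed coboundary `B_ε`, and `b` in the kernel of `B_εᵀ M`.
Rank-nullity gives dimension `m - n + 2 dim ker B_ε` (`finrank_ker_vertexSystem_of_eq_zero`). By
connectedness `ker B_1` is the line of constants; `ker B_{-1}` is a line for bipartite graphs and
zero otherwise.

The spectrum consists of eigenvalues: variation of constants reduces `(z - A) f = g` to the same
square system with a right-hand side, so injectivity yields surjectivity, and the inverse is bounded
by symmetry of `A` and the closed graph theorem. Symmetry also excludes generalized eigenvectors. A
Rayleigh quotient places the eigenvalues of `P` in `[-1,1]`, which forces `w` to be real when `S(1)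
≠ 0` and `z` is an eigenvalue. Finally `n ≤ m`, since all degrees are at least `2`, decides which of
the numbers `-k²π²` occur.

The analysis rests on `isH2_iff`, which replaces weak derivatives by Lebesgue primitives; these have
a product rule. -/

theorem AbsolutelyContinuousOnInterval.congr_of_eqOn {X : Type*} [PseudoMetricSpace X]
    {f g : ℝ → X} {a b : ℝ} (hf : AbsolutelyContinuousOnInterval f a b)
    (h : EqOn f g (uIcc a b)) : AbsolutelyContinuousOnInterval g a b := by
  rw [absolutelyContinuousOnInterval_iff] at hf ⊢
  intro ε hε
  obtain ⟨δ, hδ, H⟩ := hf ε hε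
  refine ⟨δ, hδ, fun E hE hlt => ?_⟩
  refine (Finset.sum_congr rfl fun i hi => ?_).trans_lt (H E hE hlt)
  rw [h (hE.1 i hi).1, h (hE.1 i hi).2]

/-- The real-valued case is applied to real and imaginary parts, which are recombined as multiples
of the constants `1` and `i`. -/
theorem IntervalIntegrable.absolutelyContinuousOnInterval_integral_complex {g : ℝ → ℂ} {a b : ℝ}
    (h : IntervalIntegrable g volume a b) :
    AbsolutelyContinuousOnInterval (fun x => ∫ t in a..x, g t) a b := by
  have hre : IntervalIntegrable (fun x => (g x).re) volume a b := ⟨h.1.re, h.2.re⟩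
  have him : IntervalIntegrable (fun x => (g x).im) volume a b := ⟨h.1.im, h.2.im⟩
  have cst (c : ℂ) : AbsolutelyContinuousOnInterval (fun _ : ℝ => c) a b :=
    (contDiffOn_const (n := 1)).absolutelyContinuousOnInterval
  refine (((hre.absolutelyContinuousOnInterval_intervalIntegral left_mem_uIcc).fun_smul
    (cst 1)).fun_add ((him.absolutelyContinuousOnInterval_intervalIntegral
      left_mem_uIcc).fun_smul (cst Complex.I))).congr_of_eqOn fun x hx => ?_
  have hx' : IntervalIntegrable g volume a x := h.mono_set (uIcc_subset_uIcc_left hx)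
  have e2 := Complex.reCLM.intervalIntegral_comp_comm hx'
  have e3 := Complex.imCLM.intervalIntegral_comp_comm hx'
  simp only [Complex.reCLM_apply, Complex.imCLM_apply] at e2 e3
  simp only [e2, e3, Complex.real_smul, mul_one]
  exact Complex.re_add_im _

/-- On `[0,1]`, the function `f` is a primitive of the integrable function `g`. -/
structure IsPrimitive (f g : ℝ → ℂ) : Prop where
  integrable : IntegrableOn g (Ioo 0 1)
  eq_add_integral : ∀ x ∈ Icc (0 : ℝ) 1, f x = f 0 + ∫ t in (0 : ℝ)..x, g t

namespace IsPrimitive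

variable {f g f' g' : ℝ → ℂ}

theorem intervalIntegrable (h : IsPrimitive f g) : IntervalIntegrable g volume 0 1 :=
  (intervalIntegrable_iff_integrableOn_Ioo_of_le zero_le_one).2 h.integrable

theorem absolutelyContinuous (h : IsPrimitive f g) : AbsolutelyContinuousOnInterval f 0 1 := by
  have cst : AbsolutelyContinuousOnInterval (fun _ : ℝ => f 0) 0 1 :=
    (contDiffOn_const (n := 1)).absolutelyContinuousOnInterval
  refine (cst.fun_add
    h.intervalIntegrable.absolutelyContinuousOnInterval_integral_complex).congr_of_eqOn ?_
  intro x hx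
  rw [uIcc_of_le zero_le_one] at hx
  exact (h.eq_add_integral x hx).symm

theorem continuousOn (h : IsPrimitive f g) : ContinuousOn f (Icc 0 1) := by
  simpa [uIcc_of_le] using h.absolutelyContinuous.continuousOn

theorem ae_mem_Icc_hasDerivAt (h : IsPrimitive f g) :
    ∀ᵐ x, x ∈ Icc (0 : ℝ) 1 → HasDerivAt f (g x) x := by
  have h0 : ∀ᵐ x : ℝ, x ≠ 0 := by simp [ae_iff, measure_singleton]
  have h1 : ∀ᵐ x : ℝ, x ≠ 1 := by simp [ae_iff, measure_singleton]
  filter_upwards [h.intervalIntegrable.ae_hasDerivAt_integral, h0, h1] with x hx hx0 hx1 hm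
  rw [uIcc_of_le zero_le_one] at hx
  have := (hx hm 0 (by simp)).const_add (f 0)
  refine this.congr_of_eventuallyEq ?_
  filter_upwards [Icc_mem_nhds (lt_of_le_of_ne hm.1 hx0.symm) (lt_of_le_of_ne hm.2 hx1)] with y hy
  exact h.eq_add_integral y hy

/-- `f` minus the integral of `g` is absolutely continuous with derivative zero a.e., hence
constant. Sums and products of primitives are handled through this criterion. -/
theorem of_absolutelyContinuous (hf : AbsolutelyContinuousOnInterval f 0 1)
    (hg : IntegrableOn g (Ioo 0 1))
    (hd : ∀ᵐ x, x ∈ Icc (0 : ℝ) 1 → HasDerivAt f (g x) x) : IsPrimitive f g := by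
  refine ⟨hg, ?_⟩
  have hF : IsPrimitive (fun x => ∫ t in (0 : ℝ)..x, g t) g := ⟨hg, fun x _ => by simp⟩
  obtain ⟨C, hC⟩ := (hf.fun_sub hF.absolutelyContinuous).const_of_ae_hasDerivAt_zero (by
    filter_upwards [hd, hF.ae_mem_Icc_hasDerivAt] with x h1 h2 hx
    rw [uIcc_of_le zero_le_one] at hx
    exact ((h1 hx).sub (h2 hx)).congr_deriv (sub_self _))
  rw [uIcc_of_le zero_le_one] at hC
  intro x hx
  have e0 := hC 0 (by simp)
  have e1 := hC x hx
  simp only [intervalIntegral.integral_same, sub_zero] at e0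
  rw [e0, ← e1]
  ring

theorem integral_eq (h : IsPrimitive f g) : ∫ x in Ioo (0 : ℝ) 1, g x = f 1 - f 0 := by
  rw [h.eq_add_integral 1 (by simp), intervalIntegral.integral_of_le zero_le_one,
    integral_Ioc_eq_integral_Ioo]
  ring

theorem congr_right (h : IsPrimitive f g) (hg : g =ᵐ[volume.restrict (Ioo 0 1)] g') :
    IsPrimitive f g' := by
  refine ⟨h.integrable.congr hg, fun x hx => ?_⟩
  rw [h.eq_add_integral x hx]
  congr 1
  rw [intervalIntegral.integral_of_le hx.1, intervalIntegral.integral_of_le hx.1,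
    integral_Ioc_eq_integral_Ioo, integral_Ioc_eq_integral_Ioo]
  exact integral_congr_ae (ae_restrict_of_ae_restrict_of_subset (Ioo_subset_Ioo_right hx.2) hg)

theorem add (h : IsPrimitive f g) (h' : IsPrimitive f' g') :
    IsPrimitive (fun x => f x + f' x) (fun x => g x + g' x) := by
  refine of_absolutelyContinuous (h.absolutelyContinuous.fun_add h'.absolutelyContinuous)
    (h.integrable.add h'.integrable) ?_
  filter_upwards [h.ae_mem_Icc_hasDerivAt, h'.ae_mem_Icc_hasDerivAt] with x h1 h2 hx
  exact (h1 hx).add (h2 hx)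

theorem sub (h : IsPrimitive f g) (h' : IsPrimitive f' g') :
    IsPrimitive (fun x => f x - f' x) (fun x => g x - g' x) := by
  refine of_absolutelyContinuous (h.absolutelyContinuous.fun_sub h'.absolutelyContinuous)
    (h.integrable.sub h'.integrable) ?_
  filter_upwards [h.ae_mem_Icc_hasDerivAt, h'.ae_mem_Icc_hasDerivAt] with x h1 h2 hx
  exact (h1 hx).sub (h2 hx)

theorem integrable_mul_continuousOn {p q : ℝ → ℂ} (hp : IntegrableOn p (Ioo 0 1))
    (hq : ContinuousOn q (Icc 0 1)) : IntegrableOn (fun x => p x * q x) (Ioo 0 1) := by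
  have hp' : IntervalIntegrable p volume 0 1 :=
    (intervalIntegrable_iff_integrableOn_Ioo_of_le zero_le_one).2 hp
  exact (intervalIntegrable_iff_integrableOn_Ioo_of_le zero_le_one).1
    (hp'.mul_continuousOn (by rwa [uIcc_of_le zero_le_one]))

theorem mul (h : IsPrimitive f g) (h' : IsPrimitive f' g') :
    IsPrimitive (fun x => f x * f' x) (fun x => g x * f' x + f x * g' x) := by
  refine of_absolutelyContinuous
    (by simpa only [smul_eq_mul] using h.absolutelyContinuous.fun_smul h'.absolutelyContinuous)
    ((integrable_mul_continuousOn h.integrable h'.continuousOn).add ?_) ?_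
  · simpa only [mul_comm] using integrable_mul_continuousOn h'.integrable h.continuousOn
  · filter_upwards [h.ae_mem_Icc_hasDerivAt, h'.ae_mem_Icc_hasDerivAt] with x h1 h2 hx
    exact (h1 hx).mul (h2 hx)

theorem conj (h : IsPrimitive f g) :
    IsPrimitive (fun x => starRingEnd ℂ (f x)) (fun x => starRingEnd ℂ (g x)) := by
  refine ⟨Complex.conjCLE.toContinuousLinearMap.integrable_comp h.integrable, fun x hx => ?_⟩
  have hx' : IntervalIntegrable g volume 0 x :=
    h.intervalIntegrable.mono_set (by
      rw [uIcc_of_le zero_le_one, uIcc_of_le hx.1]; exact Icc_subset_Icc_right hx.2)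
  have := Complex.conjCLE.toContinuousLinearMap.intervalIntegral_comp_comm hx'
  simp only [ContinuousLinearEquiv.coe_coe, Complex.conjCLE_apply] at this
  rw [h.eq_add_integral x hx, map_add, this]

theorem of_hasDerivAt (hf : ∀ x, HasDerivAt f (g x) x) (hg : Continuous g) : IsPrimitive f g := by
  refine ⟨(hg.integrableOn_Icc).mono_set Ioo_subset_Icc_self, fun x _ => ?_⟩
  rw [intervalIntegral.integral_eq_sub_of_hasDerivAt (fun t _ => hf t) (hg.intervalIntegrable _ _)]
  ring

/-- Integration by parts: the product rule integrated over `[0,1]`, with no boundary terms because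
`φ` vanishes at both ends. -/
theorem isWeakDeriv (h : IsPrimitive f g) : IsWeakDeriv f g := by
  refine ⟨(h.continuousOn.integrableOn_Icc).mono_set Ioo_subset_Icc_self, h.integrable, ?_⟩
  intro φ hφ hs ht
  have hφ' : IsPrimitive (fun x => (φ x : ℂ)) (fun x => ((deriv φ x : ℝ) : ℂ)) :=
    of_hasDerivAt (fun x => ((hφ.differentiable (by simp)) x).hasDerivAt.ofReal_comp)
      (Complex.continuous_ofReal.comp (hφ.continuous_deriv (by simp)))
  have z0 : φ 0 = 0 := image_eq_zero_of_notMem_tsupport fun hm => by simpa using ht hm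
  have z1 : φ 1 = 0 := image_eq_zero_of_notMem_tsupport fun hm => by simpa using ht hm
  have key := (hφ'.mul h).integral_eq
  simp only [z0, z1, Complex.ofReal_zero, zero_mul, sub_zero] at key
  have j1 : Integrable (fun x => ((deriv φ x : ℝ) : ℂ) * f x) (volume.restrict (Ioo 0 1)) :=
    integrable_mul_continuousOn hφ'.integrable h.continuousOn
  have j2 : Integrable (fun x => (φ x : ℂ) * g x) (volume.restrict (Ioo 0 1)) := by
    simp only [mul_comm]
    exact integrable_mul_continuousOn h.integrable hφ'.continuousOn
  rw [integral_add j1 j2] at key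
  simpa only [Complex.real_smul] using eq_neg_of_add_eq_zero_left key

end IsPrimitive

/-- The primitive starting at the left end of a compact interval `[a,b] ⊆ (0,1)` carrying the
support vanishes to the left of `a`; zero mean makes it vanish to the right of `b` as well. -/
theorem exists_contDiff_primitive {ψ : ℝ → ℝ} (hψ : ContDiff ℝ ∞ ψ) (hs : HasCompactSupport ψ)
    (ht : tsupport ψ ⊆ Ioo 0 1) (h0 : ∫ x, ψ x = 0) :
    ∃ φ : ℝ → ℝ, ContDiff ℝ ∞ φ ∧ HasCompactSupport φ ∧ tsupport φ ⊆ Ioo 0 1 ∧ deriv φ = ψ := by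
  obtain ⟨a, b, ha, hab, hb, hsub⟩ : ∃ a b : ℝ, 0 < a ∧ a ≤ b ∧ b < 1 ∧ tsupport ψ ⊆ Icc a b := by
    rcases (tsupport ψ).eq_empty_or_nonempty with he | hne
    · exact ⟨1 / 2, 1 / 2, by norm_num, le_rfl, by norm_num, by simp [he]⟩
    · have hc : IsCompact (tsupport ψ) := hs
      exact ⟨sInf (tsupport ψ), sSup (tsupport ψ), (ht (hc.sInf_mem hne)).1,
        csInf_le_csSup hne hc.bddBelow hc.bddAbove, (ht (hc.sSup_mem hne)).2,
        fun x hx => ⟨csInf_le hc.bddBelow hx, le_csSup hc.bddAbove hx⟩⟩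
  have hd : ∀ x, HasDerivAt (fun x => ∫ t in a..x, ψ t) (ψ x) x := fun x =>
    intervalIntegral.integral_hasDerivAt_right (hψ.continuous.intervalIntegrable _ _)
      (hψ.continuous.stronglyMeasurableAtFilter _ _) hψ.continuous.continuousAt
  have hz : ∀ x, x ∉ Icc a b → ψ x = 0 := fun x hx =>
    image_eq_zero_of_notMem_tsupport fun h => hx (hsub h)
  have hde : deriv (fun x => ∫ t in a..x, ψ t) = ψ := funext fun x => (hd x).deriv
  have hsupp : Function.support (fun x => ∫ t in a..x, ψ t) ⊆ Icc a b := by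
    intro x hx
    by_contra hn
    refine hx ?_
    rcases lt_or_ge x a with hxa | hxa
    · refine (intervalIntegral.integral_congr_ae ?_).trans intervalIntegral.integral_zero
      have hne : ∀ᵐ t : ℝ, t ≠ a := by simp [ae_iff, measure_singleton]
      filter_upwards [hne] with t hta ht
      rw [uIoc_of_ge hxa.le] at ht
      exact hz t fun h => hta (le_antisymm ht.2 h.1)
    · have hxb : b < x := by
        by_contra hh
        exact hn ⟨hxa, not_lt.1 hh⟩
      rw [← h0, ← setIntegral_eq_integral_of_forall_compl_eq_zero (s := Icc a x),
        integral_Icc_eq_integral_Ioc]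
      · exact intervalIntegral.integral_of_le hxa
      · exact fun t ht => hz t fun h => ht ⟨h.1, h.2.trans hxb.le⟩
  refine ⟨_, ?_, HasCompactSupport.of_support_subset_isCompact isCompact_Icc hsupp,
    (closure_minimal hsupp isClosed_Icc).trans fun x hx => ⟨ha.trans_le hx.1, hx.2.trans_lt hb⟩,
    hde⟩
  rw [contDiff_infty_iff_deriv, hde]
  exact ⟨fun x => (hd x).differentiableAt, hψ⟩

/-- A function whose weak derivative vanishes is constant. -/
theorem IsWeakDeriv.eqOn_const {f : ℝ → ℂ} (h : IsWeakDeriv f 0)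
    (hf : ContinuousOn f (Icc 0 1)) : ∃ c, ∀ x ∈ Icc (0 : ℝ) 1, f x = c := by
  -- A bump of integral one supported in `[1/4, 3/4]`; the constant sought is its pairing with `f`.
  let B : ContDiffBump (1 / 2 : ℝ) := ⟨1 / 8, 1 / 4, by norm_num, by norm_num⟩
  let ρ : ℝ → ℝ := B.normed volume
  have hρ : ContDiff ℝ ∞ ρ := B.contDiff_normed
  have hρs : HasCompactSupport ρ := B.hasCompactSupport_normed
  have hρt : tsupport ρ ⊆ Ioo 0 1 := by
    rw [B.tsupport_normed_eq, Real.closedBall_eq_Icc]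
    intro x hx
    constructor <;> linarith [hx.1, hx.2, show B.rOut = 1 / 4 from rfl]
  have hρ1 : ∫ x, ρ x = 1 := B.integral_normed
  set c : ℂ := ∫ x in Ioo (0 : ℝ) 1, ρ x • f x with hc
  have hint : IntegrableOn (fun x => f x - c) (Ioo 0 1) :=
    h.integrable_left.sub (integrableOn_const (by simp))
  have key := isOpen_Ioo.ae_eq_zero_of_integral_contDiff_smul_eq_zero (μ := volume)
    (U := Ioo (0 : ℝ) 1) (f := fun x => f x - c) hint.locallyIntegrableOn ?_
  · have hae : f =ᵐ[volume.restrict (Icc 0 1)] fun _ => c := by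
      rw [← restrict_Ioo_eq_restrict_Icc]
      refine (ae_restrict_iff' measurableSet_Ioo).2 ?_
      filter_upwards [key] with x hx hm
      exact sub_eq_zero.1 (hx hm)
    exact ⟨c, Measure.eqOn_Icc_of_ae_eq volume zero_ne_one hae hf continuousOn_const⟩
  · intro ψ hψ hψs hψt
    rw [← setIntegral_eq_integral_of_forall_compl_eq_zero (s := Ioo (0 : ℝ) 1)]
    swap
    · intro x hx
      rw [image_eq_zero_of_notMem_tsupport (fun hx' => hx (hψt hx')), zero_smul]
    set k : ℝ := ∫ x, ψ x with hk
    have hkU : ∫ x in Ioo (0 : ℝ) 1, ψ x = k :=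
      setIntegral_eq_integral_of_forall_compl_eq_zero fun x hx =>
        image_eq_zero_of_notMem_tsupport (fun hx' => hx (hψt hx'))
    have hi1 : Integrable ψ := hψ.continuous.integrable_of_hasCompactSupport hψs
    have hi2 : Integrable ρ := hρ.continuous.integrable_of_hasCompactSupport hρs
    -- Subtracting `k ρ` makes the mean of `ψ` zero, so the difference is the derivative of a test
    -- function and pairs to zero with `f`.
    obtain ⟨φ, hφ, hφs, hφt, hφd⟩ := exists_contDiff_primitive (ψ := fun x => ψ x - k * ρ x)
      (hψ.sub (contDiff_const.mul hρ)) (hψs.sub hρs.mul_left)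
      ((tsupport_sub ψ fun x => k * ρ x).trans
        (union_subset hψt ((tsupport_mul_subset_right).trans hρt))) (by
        rw [integral_sub hi1 (hi2.const_mul k), integral_const_mul, hρ1, mul_one, hk, sub_self])
    have h0 := h.integral_eq φ hφ hφs hφt
    have j1 := IsWeakDeriv.integrable_smul h.integrable_left hψ.continuous hψs
    have j2 := IsWeakDeriv.integrable_smul h.integrable_left hρ.continuous hρs
    have j3 : Integrable (fun x => ψ x • c) (volume.restrict (Ioo 0 1)) :=
      (hi1.integrableOn).smul_const c
    simp only [hφd, Pi.zero_apply, smul_zero, integral_zero, neg_zero, sub_smul, mul_smul] at h0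
    have j4 : Integrable (fun x => k • ρ x • f x) (volume.restrict (Ioo 0 1)) := j2.smul k
    rw [integral_sub j1 j4, integral_smul, ← hc] at h0
    simp only [smul_sub]
    rw [integral_sub j1 j3, integral_smul_const, hkU]
    exact h0

/-- Subtracting the integral of `g` from `f` leaves a continuous function with zero weak derivative,
which is constant. -/
theorem IsWeakDeriv.isPrimitive {f g : ℝ → ℂ} (h : IsWeakDeriv f g)
    (hf : ContinuousOn f (Icc 0 1)) : IsPrimitive f g := by
  have hF : IsPrimitive (fun x => ∫ t in (0 : ℝ)..x, g t) g := ⟨h.integrable_right, by simp⟩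
  have hw := h.add (hF.isWeakDeriv.const_smul (-1))
  rw [show g + (-1 : ℂ) • g = 0 by ext x; simp] at hw
  obtain ⟨c, hc⟩ := hw.eqOn_const (hf.add (hF.continuousOn.const_smul (-1 : ℂ)))
  simp only [Pi.add_apply, Pi.smul_apply, smul_eq_mul] at hc
  refine ⟨h.integrable_right, fun x hx => ?_⟩
  have e0 := hc 0 (by simp)
  have e1 := hc x hx
  simp only [intervalIntegral.integral_same] at e0
  linear_combination e1 - e0

theorem isH2_iff {u v w : ℝ → ℂ} : IsH2 u v w ↔
    IsPrimitive u v ∧ IsPrimitive v w ∧ MemLp w 2 (volume.restrict (Ioo 0 1)) :=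
  ⟨fun h => ⟨h.weak_fst.isPrimitive h.cont_left, h.weak_snd.isPrimitive h.cont_right, h.memLp⟩,
    fun h => ⟨h.1.continuousOn, h.2.1.continuousOn, h.2.2, h.1.isWeakDeriv, h.2.1.isWeakDeriv⟩⟩

/-! ### Symmetric unbounded operators -/

namespace UnboundedOp

section General

variable {H : Type*} [NormedAddCommGroup H] [NormedSpace ℂ H]

theorem mem_genKer_succ (A : H →ₗ.[ℂ] H) (z : ℂ) (k : ℕ) (f : H) :
    f ∈ genKer A z (k + 1) ↔ ∃ h : f ∈ A.domain, A ⟨f, h⟩ - z • f ∈ genKer A z k := by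
  simp only [genKer, Submodule.mem_map, Submodule.mem_comap, Submodule.subtype_apply]
  constructor
  · rintro ⟨x, hx, rfl⟩
    exact ⟨x.2, hx⟩
  · rintro ⟨h, hf⟩
    exact ⟨⟨f, h⟩, hf, rfl⟩

theorem genKer_one (A : H →ₗ.[ℂ] H) (z : ℂ) : genKer A z 1 = eigenspace A z := by
  ext f
  rw [mem_genKer_succ, mem_eigenspace]
  simp only [genKer, Submodule.mem_bot, sub_eq_zero]

theorem mem_spectrum_of_eigenspace_ne_bot {A : H →ₗ.[ℂ] H} {z : ℂ} (h : eigenspace A z ≠ ⊥) :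
    z ∈ spectrum A := by
  rintro ⟨R, -, hR⟩
  obtain ⟨f, hf, hf0⟩ := Submodule.exists_mem_ne_zero_of_ne_bot h
  obtain ⟨hd, hA⟩ := (mem_eigenspace A z f).1 hf
  apply hf0
  simpa [hA] using (hR ⟨f, hd⟩).symm

end General

section Symmetric

variable {H : Type*} [NormedAddCommGroup H] [InnerProductSpace ℂ H] {A : H →ₗ.[ℂ] H}

theorem conj_eq_of_mem_eigenspace (hA : A.IsFormalAdjoint A) {z : ℂ} {f : H}
    (hf : f ∈ eigenspace A z) (hf0 : f ≠ 0) : starRingEnd ℂ z = z := by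
  obtain ⟨hd, hz⟩ := (mem_eigenspace A z f).1 hf
  have h := hA ⟨f, hd⟩ ⟨f, hd⟩
  simp only [hz, inner_smul_left, inner_smul_right] at h
  exact mul_right_cancel₀ (inner_self_ne_zero.2 hf0) h

/-- By induction `g = (A - z) f` is an eigenvector or zero. If it is nonzero then `z` is real, and
symmetry gives `⟨g, g⟩ = ⟨f, (A - z) g⟩ = 0`. -/
theorem genKer_succ_le_eigenspace (hA : A.IsFormalAdjoint A) (z : ℂ) (k : ℕ) :
    genKer A z (k + 1) ≤ eigenspace A z := by
  induction k with
  | zero => exact (genKer_one A z).le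
  | succ k ih =>
    intro f hf
    obtain ⟨hd, hg⟩ := (mem_genKer_succ A z (k + 1) f).1 hf
    have hg' := ih hg
    rw [mem_eigenspace]
    refine ⟨hd, ?_⟩
    by_contra hne
    have hne' : A ⟨f, hd⟩ - z • f ≠ 0 := sub_ne_zero.2 hne
    have hz := conj_eq_of_mem_eigenspace hA hg' hne'
    obtain ⟨hgd, hgz⟩ := (mem_eigenspace A z _).1 hg'
    apply hne'
    rw [← inner_self_eq_zero (𝕜 := ℂ)]
    have h := hA ⟨f, hd⟩ ⟨_, hgd⟩
    simp only [hgz, inner_smul_right] at h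
    rw [inner_sub_left, inner_smul_left, hz, h, sub_self]

theorem algMult_eq_geomMult (hA : A.IsFormalAdjoint A) (z : ℂ) : algMult A z = geomMult A z := by
  have : (⨆ k, genKer A z k) = eigenspace A z := by
    refine le_antisymm (iSup_le fun k => ?_) ((genKer_one A z).ge.trans (le_iSup (genKer A z) 1))
    cases k with
    | zero => exact bot_le
    | succ k => exact genKer_succ_le_eigenspace hA z k
  rw [algMult, geomMult, this]

/-- If `z - A` and `conj z - A` are surjective and `A` is symmetric and has no eigenvalue `z`,
then the inverse of `z - A` is automatically bounded. -/
theorem mem_resolventSet_of_surjective [CompleteSpace H] (hA : A.IsFormalAdjoint A) {z : ℂ}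
    (h0 : eigenspace A z = ⊥) (hs : ∀ g : H, ∃ f : A.domain, z • (f : H) - A f = g)
    (hs' : ∀ g : H, ∃ f : A.domain, starRingEnd ℂ z • (f : H) - A f = g) :
    z ∈ resolventSet A := by
  have hinj : ∀ f f' : A.domain, z • (f : H) - A f = z • (f' : H) - A f' → f = f' := by
    intro f f' h
    have : ((f - f' : A.domain) : H) ∈ eigenspace A z := by
      rw [mem_eigenspace]
      refine ⟨(f - f').2, ?_⟩
      rw [Subtype.coe_eta, LinearPMap.map_sub, Submodule.coe_sub, smul_sub]
      rw [← sub_eq_zero] at h ⊢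
      rw [← neg_eq_zero, ← h]
      abel
    rw [h0, Submodule.mem_bot] at this
    exact sub_eq_zero.1 (Subtype.ext this)
  choose R hR using hs
  let L : H →ₗ[ℂ] H :=
    { toFun := fun g => R g
      map_add' := fun g g' => by
        rw [← Submodule.coe_add]
        congr 1
        apply hinj
        rw [hR, LinearPMap.map_add, Submodule.coe_add, smul_add, add_sub_add_comm, hR, hR]
      map_smul' := fun a g => by
        rw [RingHom.id_apply, ← Submodule.coe_smul]
        congr 1
        apply hinj
        rw [hR, LinearPMap.map_smul, Submodule.coe_smul, smul_comm, ← smul_sub, hR] }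
  have hadj : ∀ (g : H) (k : A.domain),
      inner ℂ (L g) (starRingEnd ℂ z • (k : H) - A k) = inner ℂ g (k : H) := by
    intro g k
    conv_rhs => rw [← hR g]
    rw [inner_sub_right, inner_sub_left, inner_smul_left, inner_smul_right, hA (R g) k]
    rfl
  have hcont : Continuous L := by
    refine L.continuous_of_seq_closed_graph fun u x y hu hLu => ?_
    rw [← sub_eq_zero, ← inner_self_eq_zero (𝕜 := ℂ)]
    -- Closedness of the graph: pairing `L (u n) - L x` with `y - L x = (conj z - A) k` equals `⟨u n
    -- - x, k⟩`, which tends to `0`, so `⟨y - L x, y - L x⟩ = 0`.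
    obtain ⟨k, hk⟩ := hs' (y - L x)
    have e : ∀ n, inner ℂ (L (u n) - L x) (y - L x) = inner ℂ (u n - x) (k : H) := by
      intro n
      rw [← map_sub, ← hk, hadj]
    refine tendsto_nhds_unique ((hLu.sub_const _).inner tendsto_const_nhds) ?_
    simp_rw [Function.comp_apply, e]
    rw [← inner_zero_left (𝕜 := ℂ) (k : H)]
    refine Filter.Tendsto.inner ?_ tendsto_const_nhds
    rw [← sub_self x]
    exact hu.sub_const _
  refine ⟨⟨L, hcont⟩, fun g => ⟨(R g).2, hR g⟩, fun f => ?_⟩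
  exact congrArg Subtype.val (hinj _ f (hR _))

end Symmetric

end UnboundedOp

/-! ### Kernels of complexified real matrices -/

section Complexification

variable {V : Type*} [Fintype V] [DecidableEq V]

/-- Real and imaginary parts split the complex kernel into two copies of the real one, while real
dimension is twice complex dimension. -/
theorem Matrix.finrank_ker_map_ofReal (M : Matrix V V ℝ) :
    Module.finrank ℂ (LinearMap.ker (Matrix.toLin' (M.map ((↑) : ℝ → ℂ)))) =
      Module.finrank ℝ (LinearMap.ker (Matrix.toLin' M)) := by
  have key : ∀ d : V → ℂ, M.map ((↑) : ℝ → ℂ) *ᵥ d = 0 ↔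
      M *ᵥ (fun i => (d i).re) = 0 ∧ M *ᵥ (fun i => (d i).im) = 0 := by
    intro d
    simp only [funext_iff, ← forall_and]
    refine forall_congr' fun i => ?_
    simp [Matrix.mulVec, dotProduct, Complex.ext_iff]
  let e : LinearMap.ker (Matrix.toLin' (M.map ((↑) : ℝ → ℂ))) ≃ₗ[ℝ]
      LinearMap.ker (Matrix.toLin' M) × LinearMap.ker (Matrix.toLin' M) :=
    { toFun := fun d => (⟨fun i => (d.1 i).re, ((key _).1 d.2).1⟩,
        ⟨fun i => (d.1 i).im, ((key _).1 d.2).2⟩)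
      invFun := fun p => ⟨fun i => ⟨p.1.1 i, p.2.1 i⟩, (key _).2 ⟨p.1.2, p.2.2⟩⟩
      map_add' := fun _ _ => rfl
      map_smul' := fun a d => by
        ext i <;> simp
      left_inv := fun _ => rfl
      right_inv := fun _ => rfl }
  have h := e.finrank_eq
  rw [finrank_real_of_complex, Module.finrank_prod] at h
  omega

theorem Matrix.ker_toLin'_ne_bot_iff {K : Type*} [Field K] (M : Matrix V V K) :
    LinearMap.ker (Matrix.toLin' M) ≠ ⊥ ↔ M.det = 0 := by
  rw [← Matrix.exists_mulVec_eq_zero_iff, Submodule.ne_bot_iff]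
  simp only [LinearMap.mem_ker, Matrix.toLin'_apply, ne_eq]
  exact ⟨fun ⟨v, h1, h2⟩ => ⟨v, h2, h1⟩, fun ⟨v, h1, h2⟩ => ⟨v, h2, h1⟩⟩

theorem Matrix.mem_spectrum_iff_ker_ne_bot (M : Matrix V V ℝ) (r : ℝ) :
    r ∈ spectrum ℝ M ↔
      LinearMap.ker (Matrix.toLin' ((r : ℂ) • 1 - M.map ((↑) : ℝ → ℂ))) ≠ ⊥ := by
  have e : (r : ℂ) • (1 : Matrix V V ℂ) - M.map ((↑) : ℝ → ℂ) =
      Complex.ofRealHom.mapMatrix (r • 1 - M) := by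
    ext i j
    by_cases h : i = j <;> simp [h]
  rw [Matrix.ker_toLin'_ne_bot_iff, e, ← RingHom.map_det, spectrum.mem_iff,
    Matrix.isUnit_iff_isUnit_det, isUnit_iff_ne_zero, not_not, Algebra.algebraMap_eq_smul_one]
  simp

end Complexification

/-! ### The vertex system of a network -/

namespace EdgeParam

variable {V : Type*} {G : SimpleGraph V} (o : EdgeParam G)

theorem adj (e : G.edgeSet) : G.Adj (o.zero e) (o.one e) := by
  have := e.2
  rwa [← o.ends e] at this

theorem mem_iff (e : G.edgeSet) (i : V) : i ∈ (e : Sym2 V) ↔ o.zero e = i ∨ o.one e = i := by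
  rw [← o.ends e, Sym2.mem_iff, eq_comm, @eq_comm _ i (o.one e)]

theorem exists_edge {i k : V} (h : G.Adj i k) :
    ∃ e : G.edgeSet, (o.zero e = i ∧ o.one e = k) ∨ (o.zero e = k ∧ o.one e = i) := by
  refine ⟨⟨s(i, k), h⟩, ?_⟩
  have := o.ends ⟨s(i, k), h⟩
  simpa [Sym2.eq_iff] using this

theorem eq_of_connected (hG : G.Connected) {X : Type*} {d : V → X}
    (h : ∀ e, d (o.zero e) = d (o.one e)) (i k : V) : d i = d k := by
  obtain ⟨p⟩ := hG.preconnected i k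
  induction p with
  | nil => rfl
  | cons hadj _ ih =>
    rw [← ih]
    obtain ⟨e, ⟨rfl, rfl⟩ | ⟨rfl, rfl⟩⟩ := o.exists_edge hadj
    exacts [h e, (h e).symm]

variable [DecidableEq V] [Fintype G.edgeSet]

/-- A simple graph has at most one edge between `i` and `k` and no loops, so each matrix entry is a
sum over edges with at most one nonzero term, in exactly one of the two orientations. -/
theorem sum_edges_eq_mulVec [Fintype V] [DecidableRel G.Adj] (μ : G.edgeSet → ℝ) (d : V → ℂ)
    (i : V) : ((wAdjMatrix G μ).map ((↑) : ℝ → ℂ) *ᵥ d) i =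
      (∑ e, if o.zero e = i then (μ e : ℂ) * d (o.one e) else 0) +
        ∑ e, if o.one e = i then (μ e : ℂ) * d (o.zero e) else 0 := by
  have entry : ∀ k, ((wAdjMatrix G μ i k : ℝ) : ℂ) =
      ∑ e, ((if o.zero e = i ∧ o.one e = k then (μ e : ℂ) else 0) +
        if o.one e = i ∧ o.zero e = k then (μ e : ℂ) else 0) := by
    intro k
    have h1 : ∀ e : G.edgeSet, ((if o.zero e = i ∧ o.one e = k then (μ e : ℂ) else 0) +
        if o.one e = i ∧ o.zero e = k then (μ e : ℂ) else 0) =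
        if (e : Sym2 V) = s(i, k) then (μ e : ℂ) else 0 := by
      intro e
      have hne := (o.adj e).ne
      rw [← o.ends e]
      simp only [Sym2.eq_iff]
      rw [if_congr (and_comm (a := o.one e = i)) rfl rfl]
      by_cases h1 : o.zero e = i ∧ o.one e = k
      · rw [if_pos h1, if_neg fun h2 => hne (h1.1.trans h2.2.symm), if_pos (Or.inl h1), add_zero]
      · rw [if_neg h1, zero_add]
        exact if_congr (by tauto) rfl rfl
    rw [Finset.sum_congr rfl fun e _ => h1 e]
    unfold wAdjMatrix
    split_ifs with h
    · rw [Finset.sum_eq_single ⟨s(i, k), h⟩]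
      · simp
      · intro e _ he
        rw [if_neg]
        exact fun h' => he (Subtype.ext h')
      · simp
    · refine (Complex.ofReal_zero).trans (Finset.sum_eq_zero fun e _ => ?_).symm
      rw [if_neg]
      intro he
      exact h (by simpa [he] using e.2)
  simp only [Matrix.mulVec, dotProduct, Matrix.map_apply, entry, Finset.sum_mul]
  rw [Finset.sum_comm, ← Finset.sum_add_distrib]
  refine Finset.sum_congr rfl fun e _ => ?_
  simp only [add_mul, Finset.sum_add_distrib, ite_mul, zero_mul]
  congr 1
  · by_cases h : o.zero e = i <;> simp [h]
  · by_cases h : o.one e = i <;> simp [h]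

theorem sum_edges_eq_degree (μ : G.edgeSet → ℝ) (i : V) :
    (∑ e : G.edgeSet, if i ∈ (e : Sym2 V) then μ e else 0) =
      (∑ e, if o.zero e = i then μ e else 0) + ∑ e, if o.one e = i then μ e else 0 := by
  rw [← Finset.sum_add_distrib]
  refine Finset.sum_congr rfl fun e _ => ?_
  have hne := (o.adj e).ne
  simp only [o.mem_iff]
  by_cases h1 : o.zero e = i
  · have h2 : o.one e ≠ i := fun h2 => hne (h1.trans h2.symm)
    simp [h1, h2]
  · simp [h1]

end EdgeParam

/-! ### Weighted degrees and the spectral theory of the transition matrix. -/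

section WeightedDegree

variable {V : Type*} [DecidableEq V] {G : SimpleGraph V} [Fintype G.edgeSet] (μ : G.edgeSet → ℝ)

/-- The weighted degree of a vertex. -/
noncomputable def wDegree (i : V) : ℝ := ∑ e : G.edgeSet, if i ∈ (e : Sym2 V) then μ e else 0

variable {μ}

theorem wDegree_pos (hμ : ∀ e, 0 < μ e) (hG : ∀ i, ∃ k, G.Adj i k) (i : V) : 0 < wDegree μ i := by
  obtain ⟨k, h⟩ := hG i
  refine Finset.sum_pos' (fun e _ => ?_) ⟨⟨s(i, k), h⟩, Finset.mem_univ _, ?_⟩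
  · split_ifs
    exacts [(hμ e).le, le_rfl]
  · simpa using hμ _

/-- The inverse of a diagonal matrix is defined through `Ring.inverse` of the whole diagonal; it is
the entrywise inverse because no weighted degree vanishes. -/
theorem wTransitionMatrix_apply [Fintype V] [DecidableRel G.Adj] (hμ : ∀ e, 0 < μ e)
    (hG : ∀ i, ∃ k, G.Adj i k) (i k : V) :
    wTransitionMatrix G μ i k = (wDegree μ i)⁻¹ * wAdjMatrix G μ i k := by
  have h : IsUnit (wDegree μ) := Pi.isUnit_iff.2 fun i => (wDegree_pos hμ hG i).ne'.isUnit
  have hd : wDegMatrix G μ = Matrix.diagonal (wDegree μ) := by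
    unfold wDegMatrix wDegree
    congr!
  rw [wTransitionMatrix, hd, Matrix.inv_diagonal, Matrix.diagonal_mul]
  congr 1
  obtain ⟨w, hw⟩ := h
  rw [← hw, Ring.inverse_unit, hw]
  refine eq_inv_of_mul_eq_one_left ?_
  rw [← hw]
  exact congrFun (w.inv_mul) i

theorem wTransitionMatrix_mulVec [Fintype V] [DecidableRel G.Adj] (hμ : ∀ e, 0 < μ e)
    (hG : ∀ i, ∃ k, G.Adj i k) (d : V → ℂ) (i : V) :
    ((wTransitionMatrix G μ).map ((↑) : ℝ → ℂ) *ᵥ d) i =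
      (wDegree μ i : ℂ)⁻¹ * ((wAdjMatrix G μ).map ((↑) : ℝ → ℂ) *ᵥ d) i := by
  simp [Matrix.mulVec, dotProduct, wTransitionMatrix_apply hμ hG, Finset.mul_sum, mul_assoc]

/-- The eigenvalue equation cleared of the inverse degrees and written over edges, which is the form
produced by the vertex system. -/
theorem mem_ker_sub_wTransitionMatrix_iff [Fintype V] [DecidableRel G.Adj] (o : EdgeParam G)
    (hμ : ∀ e, 0 < μ e) (hG : ∀ i, ∃ k, G.Adj i k) (α : ℂ) (d : V → ℂ) :
    d ∈ LinearMap.ker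
      (Matrix.toLin' (α • 1 - (wTransitionMatrix G μ).map ((↑) : ℝ → ℂ))) ↔
    ∀ i, (∑ e, if o.zero e = i then (μ e : ℂ) * d (o.one e) else 0) +
        (∑ e, if o.one e = i then (μ e : ℂ) * d (o.zero e) else 0) = α * (wDegree μ i * d i) := by
  rw [LinearMap.mem_ker, Matrix.toLin'_apply, Matrix.sub_mulVec, Matrix.smul_mulVec,
    Matrix.one_mulVec, sub_eq_zero, funext_iff]
  refine forall_congr' fun i => ?_
  have hne : (wDegree μ i : ℂ) ≠ 0 := by exact_mod_cast (wDegree_pos hμ hG i).ne'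
  rw [wTransitionMatrix_mulVec hμ hG, o.sum_edges_eq_mulVec, Pi.smul_apply, smul_eq_mul]
  constructor
  · intro h
    rw [mul_left_comm, h, mul_inv_cancel_left₀ hne]
  · intro h
    rw [h, mul_left_comm, inv_mul_cancel_left₀ hne]

theorem sum_wDegree_mul_normSq [Fintype V] (o : EdgeParam G) (d : V → ℂ) :
    ∑ i, wDegree μ i * Complex.normSq (d i) =
      ∑ e, μ e * (Complex.normSq (d (o.zero e)) + Complex.normSq (d (o.one e))) := by
  simp only [wDegree, o.sum_edges_eq_degree, add_mul, Finset.sum_add_distrib,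
    Finset.sum_mul, mul_add, ite_mul, zero_mul]
  congr 1 <;> rw [Finset.sum_comm] <;> simp

/-- The Rayleigh quotient of an eigenvector of the transition matrix, as a sum over the edges. -/
theorem rayleigh_of_mem_ker_sub_wTransitionMatrix [Fintype V] [DecidableRel G.Adj]
    (o : EdgeParam G) (hμ : ∀ e, 0 < μ e) (hG : ∀ i, ∃ k, G.Adj i k) {α : ℂ} {d : V → ℂ}
    (hd : d ∈ LinearMap.ker
      (Matrix.toLin' (α • 1 - (wTransitionMatrix G μ).map ((↑) : ℝ → ℂ)))) :
    α * (∑ i, wDegree μ i * Complex.normSq (d i) : ℝ) =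
      (∑ e, μ e * (2 * (starRingEnd ℂ (d (o.zero e)) * d (o.one e)).re) : ℝ) := by
  rw [mem_ker_sub_wTransitionMatrix_iff o hμ hG] at hd
  have h1 : α * (∑ i, wDegree μ i * Complex.normSq (d i) : ℝ) =
      ∑ i, starRingEnd ℂ (d i) * (α * (wDegree μ i * d i)) := by
    rw [Complex.ofReal_sum, Finset.mul_sum]
    refine Finset.sum_congr rfl fun i _ => ?_
    rw [Complex.ofReal_mul, Complex.normSq_eq_conj_mul_self]
    ring
  rw [h1, Finset.sum_congr rfl fun i _ => by rw [← hd i]]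
  simp only [mul_add, Finset.sum_add_distrib, Finset.mul_sum, mul_ite, mul_zero]
  rw [Finset.sum_comm, Finset.sum_comm (f := fun i e => if o.one e = i then _ else _),
    ← Finset.sum_add_distrib, Complex.ofReal_sum]
  refine Finset.sum_congr rfl fun e _ => ?_
  simp only [Finset.sum_ite_eq, Finset.mem_univ, if_true]
  have := Complex.add_conj (starRingEnd ℂ (d (o.zero e)) * d (o.one e))
  simp only [map_mul, Complex.conj_conj] at this
  rw [Complex.ofReal_mul, ← this]
  ring

theorem sum_wDegree_mul_normSq_pos [Fintype V] (hμ : ∀ e, 0 < μ e)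
    (hG : ∀ i, ∃ k, G.Adj i k) {d : V → ℂ} (hd : d ≠ 0) :
    0 < ∑ i, wDegree μ i * Complex.normSq (d i) := by
  obtain ⟨i₀, hi₀⟩ := Function.ne_iff.1 hd
  exact Finset.sum_pos'
    (fun i _ => mul_nonneg (wDegree_pos hμ hG i).le (Complex.normSq_nonneg _))
    ⟨i₀, Finset.mem_univ _, mul_pos (wDegree_pos hμ hG i₀) (Complex.normSq_pos.2 hi₀)⟩

/-- The eigenvalues of the transition matrix are real and lie in `[-1,1]`. -/
theorem exists_real_of_ker_sub_wTransitionMatrix_ne_bot [Fintype V] [DecidableRel G.Adj]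
    (o : EdgeParam G) (hμ : ∀ e, 0 < μ e) (hG : ∀ i, ∃ k, G.Adj i k) {α : ℂ}
    (h : LinearMap.ker
      (Matrix.toLin' (α • 1 - (wTransitionMatrix G μ).map ((↑) : ℝ → ℂ))) ≠ ⊥) :
    ∃ r : ℝ, α = r ∧ -1 ≤ r ∧ r ≤ 1 := by
  obtain ⟨d, hd, hd0⟩ := Submodule.exists_mem_ne_zero_of_ne_bot h
  have hQpos := sum_wDegree_mul_normSq_pos hμ hG hd0
  have hαQ := rayleigh_of_mem_ker_sub_wTransitionMatrix o hμ hG hd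
  set N : ℝ := ∑ e, μ e * (2 * (starRingEnd ℂ (d (o.zero e)) * d (o.one e)).re) with hN
  -- This is `|a ± b|² ≥ 0` expanded.
  have bound : ∀ a b : ℂ, |2 * (starRingEnd ℂ a * b).re| ≤ Complex.normSq a + Complex.normSq b := by
    intro a b
    rw [abs_le]
    simp only [Complex.normSq_apply, Complex.mul_re, Complex.conj_re, Complex.conj_im]
    constructor
    · nlinarith [sq_nonneg (a.re + b.re), sq_nonneg (a.im + b.im)]
    · nlinarith [sq_nonneg (a.re - b.re), sq_nonneg (a.im - b.im)]
  have hNQ : |N| ≤ ∑ i, wDegree μ i * Complex.normSq (d i) := by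
    rw [sum_wDegree_mul_normSq o, hN]
    refine (Finset.abs_sum_le_sum_abs _ _).trans (Finset.sum_le_sum fun e _ => ?_)
    rw [abs_mul, abs_of_pos (hμ e)]
    exact mul_le_mul_of_nonneg_left (bound _ _) (hμ e).le
  set Q : ℝ := ∑ i, wDegree μ i * Complex.normSq (d i)
  refine ⟨N / Q, ?_, ?_, ?_⟩
  · rw [Complex.ofReal_div, eq_div_iff (by exact_mod_cast hQpos.ne'), hαQ]
  · rw [le_div_iff₀ hQpos]
    linarith [(abs_le.1 hNQ).1]
  · rw [div_le_one hQpos]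
    exact (abs_le.1 hNQ).2

/-- The eigenvalue `1` of the transition matrix of a connected graph is simple. -/
theorem finrank_ker_one_sub_wTransitionMatrix [Fintype V] [DecidableRel G.Adj]
    (o : EdgeParam G) (hμ : ∀ e, 0 < μ e) (hG : ∀ i, ∃ k, G.Adj i k) (hc : G.Connected) :
    Module.finrank ℂ (LinearMap.ker
      (Matrix.toLin' ((1 : ℂ) • 1 - (wTransitionMatrix G μ).map ((↑) : ℝ → ℂ)))) = 1 := by
  have hspan : LinearMap.ker
      (Matrix.toLin' ((1 : ℂ) • 1 - (wTransitionMatrix G μ).map ((↑) : ℝ → ℂ))) =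
      ℂ ∙ (1 : V → ℂ) := by
    ext d
    rw [Submodule.mem_span_singleton]
    constructor
    · intro hd
      have h := rayleigh_of_mem_ker_sub_wTransitionMatrix o hμ hG hd
      rw [one_mul, Complex.ofReal_inj, sum_wDegree_mul_normSq o, ← sub_eq_zero,
        ← Finset.sum_sub_distrib] at h
      -- For `α = 1` the Rayleigh identity says that the Dirichlet energy `∑ μ_e |d(e(0)) -
      -- d(e(1))|²` is zero.
      have hterm : ∀ e, μ e * (Complex.normSq (d (o.zero e)) + Complex.normSq (d (o.one e))) -
          μ e * (2 * (starRingEnd ℂ (d (o.zero e)) * d (o.one e)).re) =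
          μ e * Complex.normSq (d (o.zero e) - d (o.one e)) := by
        intro e
        simp only [Complex.normSq_apply, Complex.mul_re, Complex.conj_re, Complex.conj_im,
          Complex.sub_re, Complex.sub_im]
        ring
      rw [Finset.sum_congr rfl fun e _ => hterm e, Finset.sum_eq_zero_iff_of_nonneg
        fun e _ => mul_nonneg (hμ e).le (Complex.normSq_nonneg _)] at h
      have he : ∀ e, d (o.zero e) = d (o.one e) := fun e => by
        simpa [(hμ e).ne', sub_eq_zero] using h e (Finset.mem_univ e)
      obtain ⟨i⟩ := hc.nonempty
      exact ⟨d i, funext fun k => by simpa using o.eq_of_connected hc he i k⟩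
    · rintro ⟨a, rfl⟩
      refine Submodule.smul_mem _ a ?_
      rw [mem_ker_sub_wTransitionMatrix_iff o hμ hG]
      intro i
      simp only [wDegree, o.sum_edges_eq_degree, Pi.one_apply, mul_one, one_mul,
        Complex.ofReal_add, Complex.ofReal_sum, apply_ite ((↑) : ℝ → ℂ), Complex.ofReal_zero]
  have := hc.nonempty
  rw [hspan, finrank_span_singleton one_ne_zero]

theorem wDegree_eq_of_const [Fintype V] [DecidableRel G.Adj] {a : ℝ} (h : ∀ e, μ e = a) (i : V) :
    wDegree μ i = a * G.degree i := by
  have hs : wDegree μ i = ∑ e ∈ G.edgeFinset, if i ∈ e then a else 0 := by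
    rw [Finset.sum_subtype (F := inferInstance) (p := (· ∈ G.edgeSet)) G.edgeFinset fun e => by simp]
    exact Finset.sum_congr rfl fun e _ => by rw [h e]
  rw [hs, ← Finset.sum_filter, Finset.sum_const, ← G.incidenceFinset_eq_filter,
    G.card_incidenceFinset_eq_degree, nsmul_eq_mul, mul_comm]

/-- A common weight cancels between the adjacency matrix and the degrees, so weights `a` and `1`
give the same matrix. -/
theorem wTransitionMatrix_eq_transitionMatrix [Fintype V] [DecidableRel G.Adj]
    (hμ : ∀ e, 0 < μ e) (hG : ∀ i, ∃ k, G.Adj i k) (h : ∀ e e', μ e = μ e') :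
    wTransitionMatrix G μ = transitionMatrix G := by
  have one : wTransitionMatrix G (fun _ => 1) = transitionMatrix G := by
    rw [wTransitionMatrix, transitionMatrix]
    congr 2
    · unfold wDegMatrix SimpleGraph.degMatrix
      congr 1
      ext i
      rw [← one_mul (G.degree i : ℝ),
        ← wDegree_eq_of_const (μ := fun _ : G.edgeSet => (1 : ℝ)) (fun _ => rfl) i, wDegree]
      congr!
  rw [← one]
  ext i k
  rw [wTransitionMatrix_apply hμ hG, wTransitionMatrix_apply (fun _ => one_pos) hG]
  obtain ⟨j, hj⟩ := hG i
  have ha := fun e => h e ⟨s(i, j), hj⟩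
  have hp := hμ ⟨s(i, j), hj⟩
  set a := μ ⟨s(i, j), hj⟩
  rw [wDegree_eq_of_const ha, wDegree_eq_of_const (a := 1) fun _ => rfl]
  simp only [wAdjMatrix, ha]
  split_ifs
  · rw [mul_inv, mul_comm a⁻¹, mul_assoc, inv_mul_cancel₀ hp.ne', one_mul]
  · simp

end WeightedDegree

namespace EdgeParam

/-! ### Kernels of the signed coboundary for `ε = 1` and `ε = -1`. -/

section Coboundary

variable {V : Type*} [DecidableEq V] {G : SimpleGraph V} (o : EdgeParam G)

/-- The signed coboundary `d ↦ ε d(e(0)) - d(e(1))`. -/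
def coboundary (ε : ℂ) : Matrix G.edgeSet V ℂ :=
  fun e i => (if o.zero e = i then ε else 0) - if o.one e = i then 1 else 0

theorem coboundary_mulVec [Fintype V] (ε : ℂ) (d : V → ℂ) (e : G.edgeSet) :
    (o.coboundary ε *ᵥ d) e = d (o.zero e) * ε - d (o.one e) := by
  simp [Matrix.mulVec, dotProduct, coboundary, sub_mul, Finset.sum_sub_distrib, mul_comm ε]

theorem finrank_ker_coboundary_one [Fintype V] (hG : G.Connected) :
    Module.finrank ℂ (LinearMap.ker (o.coboundary 1).mulVecLin) = 1 := by
  have hspan : LinearMap.ker (o.coboundary 1).mulVecLin = ℂ ∙ (1 : V → ℂ) := by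
    ext d
    rw [Submodule.mem_span_singleton, LinearMap.mem_ker, Matrix.mulVecLin_apply, funext_iff]
    simp only [coboundary_mulVec, mul_one, Pi.zero_apply, sub_eq_zero]
    constructor
    · intro h
      obtain ⟨i⟩ := hG.nonempty
      exact ⟨d i, funext fun k => by simpa using o.eq_of_connected hG h i k⟩
    · rintro ⟨a, rfl⟩ e
      rfl
  have := hG.nonempty
  rw [hspan, finrank_span_singleton one_ne_zero]

/-- Multiplication by the sign `s` of a two-colouring turns alternating functions into functions
constant along edges, so `s` spans the kernel. -/
theorem finrank_ker_coboundary_neg_one_of_isBipartite [Fintype V] (hG : G.Connected)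
    (hb : G.IsBipartite) :
    Module.finrank ℂ (LinearMap.ker (o.coboundary (-1)).mulVecLin) = 1 := by
  obtain ⟨c⟩ := hb
  let s : V → ℂ := fun i => if c i = 0 then 1 else -1
  have hss : ∀ i, s i * s i = 1 := by
    intro i
    simp only [s]
    split_ifs <;> norm_num
  have hs : ∀ e, s (o.one e) = -s (o.zero e) := by
    intro e
    have := c.valid (o.adj e)
    simp only [s]
    generalize c (o.one e) = x at *
    generalize c (o.zero e) = y at *
    fin_cases x <;> fin_cases y <;> simp_all
  have : LinearMap.ker (o.coboundary (-1)).mulVecLin = ℂ ∙ s := by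
    ext d
    rw [Submodule.mem_span_singleton, LinearMap.mem_ker, Matrix.mulVecLin_apply, funext_iff]
    simp only [coboundary_mulVec, Pi.zero_apply, sub_eq_zero]
    constructor
    · intro h
      obtain ⟨i⟩ := hG.nonempty
      refine ⟨s i * d i, funext fun k => ?_⟩
      have := o.eq_of_connected hG (d := fun i => s i * d i)
        (fun e => by rw [← h e, hs e]; ring) i k
      rw [Pi.smul_apply, smul_eq_mul, this, mul_right_comm, hss, one_mul]
    · rintro ⟨a, rfl⟩ e
      simp [hs e]
  have hs0 : s ≠ 0 := by
    obtain ⟨i⟩ := hG.nonempty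
    intro h
    simpa [h] using hss i
  rw [this, finrank_span_singleton hs0]

/-- A nonzero kernel element changes sign along every edge and has constant square; its sign
relative to a base vertex would be a two-colouring. -/
theorem finrank_ker_coboundary_neg_one_of_not_isBipartite [Fintype V] (hG : G.Connected)
    (hb : ¬ G.IsBipartite) :
    Module.finrank ℂ (LinearMap.ker (o.coboundary (-1)).mulVecLin) = 0 := by
  rw [Submodule.finrank_eq_zero, Submodule.eq_bot_iff]
  intro d hd
  rw [LinearMap.mem_ker, Matrix.mulVecLin_apply, funext_iff] at hd
  simp only [coboundary_mulVec, Pi.zero_apply, sub_eq_zero] at hd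
  by_contra h0
  obtain ⟨i₀, hi₀⟩ := Function.ne_iff.1 h0
  have hsq := o.eq_of_connected hG (d := fun i => d i ^ 2) (fun e => by rw [← hd e]; ring) i₀
  apply hb
  have hadj : ∀ {i k : V}, G.Adj i k → d i = -d k := by
    intro i k h
    obtain ⟨e, ⟨rfl, rfl⟩ | ⟨rfl, rfl⟩⟩ := o.exists_edge h <;> rw [← hd e] <;> ring
  refine ⟨SimpleGraph.Coloring.mk (fun i => if d i = d i₀ then (0 : Fin 2) else 1) ?_⟩
  intro i k h hc
  have hi := sq_eq_sq_iff_eq_or_eq_neg.1 (hsq i).symm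
  have hk := sq_eq_sq_iff_eq_or_eq_neg.1 (hsq k).symm
  have hik := hadj h
  have hne : d i₀ ≠ -d i₀ := fun h => hi₀ (self_eq_neg.1 h)
  have hne' : -d i₀ ≠ d i₀ := hne.symm
  rcases hi with hi | hi <;> rcases hk with hk | hk
  · rw [hi, hk] at hik; exact hne hik
  · simp [hi, hk, hne'] at hc
  · simp [hi, hk, hne'] at hc
  · rw [hi, hk, neg_neg] at hik; exact hne' hik

end Coboundary

/-! ### The finite linear system encoding the boundary conditions. -/

section VertexSystem

variable {V : Type*} [DecidableEq V] {G : SimpleGraph V} [Fintype G.edgeSet] (o : EdgeParam G)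
  (μ : G.edgeSet → ℝ)

/-- The boundary conditions for `u e x = d (zero e) * C x + b e * S x`, where `C' = z S`, `S' = C`,
in terms of the vertex values `d`, the slopes `b` at `0`, and the values `C = C 1`, `S = S 1`. -/
def vertexSystem (z C S : ℂ) :
    ((V → ℂ) × (G.edgeSet → ℂ)) →ₗ[ℂ] ((G.edgeSet → ℂ) × (V → ℂ)) where
  toFun p := (fun e => p.1 (o.zero e) * C + p.2 e * S - p.1 (o.one e),
    fun i => (∑ e, if o.zero e = i then (μ e : ℂ) * p.2 e else 0) -
      ∑ e, if o.one e = i then (μ e : ℂ) * (p.1 (o.zero e) * (z * S) + p.2 e * C) else 0)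
  map_add' p q := by
    ext x
    · simp only [Prod.fst_add, Prod.snd_add, Pi.add_apply]
      ring
    · simp only [Prod.fst_add, Prod.snd_add, Pi.add_apply]
      rw [sub_add_sub_comm, ← Finset.sum_add_distrib, ← Finset.sum_add_distrib]
      congr 1 <;>
      · refine Finset.sum_congr rfl fun e _ => ?_
        split_ifs <;> ring
  map_smul' a p := by
    ext x
    · simp only [Prod.smul_fst, Prod.smul_snd, Pi.smul_apply, smul_eq_mul, RingHom.id_apply]
      ring
    · simp only [Prod.smul_fst, Prod.smul_snd, Pi.smul_apply, smul_eq_mul, RingHom.id_apply]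
      rw [mul_sub, Finset.mul_sum, Finset.mul_sum]
      congr 1 <;>
      · refine Finset.sum_congr rfl fun e _ => ?_
        split_ifs <;> ring

theorem mem_ker_vertexSystem_iff (z C S : ℂ) (p : (V → ℂ) × (G.edgeSet → ℂ)) :
    p ∈ LinearMap.ker (o.vertexSystem μ z C S) ↔
      (∀ e, p.1 (o.zero e) * C + p.2 e * S = p.1 (o.one e)) ∧
      ∀ i, (∑ e, if o.zero e = i then (μ e : ℂ) * p.2 e else 0) =
        ∑ e, if o.one e = i then (μ e : ℂ) * (p.1 (o.zero e) * (z * S) + p.2 e * C) else 0 := by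
  simp [vertexSystem, Prod.ext_iff, funext_iff, sub_eq_zero]

variable {μ}

/-- If `S ≠ 0`, the solutions of the vertex system are the eigenvectors of the transition matrix
for the eigenvalue `C`. -/
theorem finrank_ker_vertexSystem_of_ne_zero [Fintype V] [DecidableRel G.Adj] (hμ : ∀ e, 0 < μ e)
    (hG : ∀ i, ∃ k, G.Adj i k) {z C S : ℂ} (hS : S ≠ 0) (hCS : C ^ 2 - z * S ^ 2 = 1) :
    Module.finrank ℂ (LinearMap.ker (o.vertexSystem μ z C S)) =
      Module.finrank ℂ (LinearMap.ker
        (Matrix.toLin' (C • 1 - (wTransitionMatrix G μ).map ((↑) : ℝ → ℂ)))) := by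
  set K := LinearMap.ker (o.vertexSystem μ z C S) with hK
  have hb : ∀ p ∈ K, ∀ e, p.2 e = (p.1 (o.one e) - p.1 (o.zero e) * C) / S := by
    intro p hp e
    rw [eq_div_iff hS, ← ((o.mem_ker_vertexSystem_iff μ z C S p).1 hp).1 e]
    ring
  let F : K →ₗ[ℂ] (V → ℂ) := (LinearMap.fst ℂ _ _).comp K.subtype
  have hF : Function.Injective F := by
    intro p q h
    have h' : p.1.1 = q.1.1 := h
    refine Subtype.ext (Prod.ext h' (funext fun e => ?_))
    rw [hb _ p.2, hb _ q.2, h']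
  rw [← LinearMap.finrank_range_of_inj hF]
  have key : ∀ d : V → ℂ, (∀ i, (∑ e, if o.zero e = i then
        (μ e : ℂ) * ((d (o.one e) - d (o.zero e) * C) / S) else 0) =
      ∑ e, if o.one e = i then (μ e : ℂ) * (d (o.zero e) * (z * S) +
        (d (o.one e) - d (o.zero e) * C) / S * C) else 0) ↔
      d ∈ LinearMap.ker
        (Matrix.toLin' (C • 1 - (wTransitionMatrix G μ).map ((↑) : ℝ → ℂ))) := by
    intro d
    rw [mem_ker_sub_wTransitionMatrix_iff o hμ hG]
    refine forall_congr' fun i => ?_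
    -- Multiplied by `S`, an edge leaving `i` contributes the required term directly; an edge
    -- entering `i` does so after `C² - z S² = 1`.
    have e1 : S * ((∑ e, if o.zero e = i then
          (μ e : ℂ) * ((d (o.one e) - d (o.zero e) * C) / S) else 0) -
        ∑ e, if o.one e = i then (μ e : ℂ) * (d (o.zero e) * (z * S) +
          (d (o.one e) - d (o.zero e) * C) / S * C) else 0) =
        (∑ e, if o.zero e = i then (μ e : ℂ) * d (o.one e) else 0) +
        (∑ e, if o.one e = i then (μ e : ℂ) * d (o.zero e) else 0) -
          C * (wDegree μ i * d i) := by
      have hdeg : (wDegree μ i : ℂ) = ∑ e, (((if o.zero e = i then μ e else 0) +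
          if o.one e = i then μ e else 0 : ℝ) : ℂ) := by
        rw [wDegree, o.sum_edges_eq_degree, ← Finset.sum_add_distrib, Complex.ofReal_sum]
      rw [hdeg, Finset.sum_mul, Finset.mul_sum, ← Finset.sum_sub_distrib,
        ← Finset.sum_add_distrib, ← Finset.sum_sub_distrib, Finset.mul_sum]
      refine Finset.sum_congr rfl fun e _ => ?_
      have hne := (o.adj e).ne
      by_cases h1 : o.zero e = i
      · have h2 : o.one e ≠ i := fun h2 => hne (h1.trans h2.symm)
        simp only [h1, h2, if_true, if_false]
        push_cast
        field_simp
        ring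
      · by_cases h2 : o.one e = i
        · simp only [h1, h2, if_true, if_false]
          push_cast
          field_simp
          linear_combination (μ e * d (o.zero e) : ℂ) * hCS
        · simp [h1, h2]
    rw [← sub_eq_zero, ← sub_eq_zero (a := _ + _), ← e1, mul_eq_zero, or_iff_right hS]
  have hrange : LinearMap.range F = LinearMap.ker
      (Matrix.toLin' (C • 1 - (wTransitionMatrix G μ).map ((↑) : ℝ → ℂ))) := by
    ext d
    rw [← key]
    constructor
    · rintro ⟨p, rfl⟩ i
      have := ((o.mem_ker_vertexSystem_iff μ z C S p).1 p.2).2 i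
      simp only [hb _ p.2] at this
      exact this
    · intro h
      exact ⟨⟨(d, fun e => (d (o.one e) - d (o.zero e) * C) / S),
        (o.mem_ker_vertexSystem_iff μ z C S _).2 ⟨fun e => by field_simp; ring, h⟩⟩, rfl⟩
  rw [hrange]

/-- With `S = 0` the kernel is `ker B × ker (Bᵀ D)` for the coboundary `B` and the invertible weight
matrix `D`. Both matrices have the same rank `r`, so the dimension is `(n - r) + (m - r) = m - n + 2
(n - r)`. -/
theorem finrank_ker_vertexSystem_of_eq_zero [Fintype V] (hμ : ∀ e, 0 < μ e) {z ε : ℂ}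
    (hε : ε ^ 2 = 1) :
    Module.finrank ℂ (LinearMap.ker (o.vertexSystem μ z ε 0)) + Fintype.card V =
      Fintype.card G.edgeSet + 2 * Module.finrank ℂ (LinearMap.ker (o.coboundary ε).mulVecLin) := by
  classical
  set B := o.coboundary ε with hB
  set D : Matrix G.edgeSet G.edgeSet ℂ := Matrix.diagonal fun e => (μ e : ℂ) with hD
  have hDet : D.det ≠ 0 := by
    rw [hD, Matrix.det_diagonal, Finset.prod_ne_zero_iff]
    exact fun e _ => by exact_mod_cast (hμ e).ne'
  have h1 : LinearMap.ker (o.vertexSystem μ z ε 0) =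
      (LinearMap.ker B.mulVecLin).prod (LinearMap.ker (Bᵀ * D).mulVecLin) := by
    ext p
    rw [mem_ker_vertexSystem_iff, Submodule.mem_prod, LinearMap.mem_ker, LinearMap.mem_ker,
      Matrix.mulVecLin_apply, Matrix.mulVecLin_apply, funext_iff, funext_iff]
    refine and_congr (forall_congr' fun e => ?_) (forall_congr' fun i => ?_)
    · simp [hB, coboundary_mulVec, sub_eq_zero]
    · have h2 : ((Bᵀ * D) *ᵥ p.2) i = ε * ((∑ e, if o.zero e = i then (μ e : ℂ) * p.2 e else 0) -
          ∑ e, if o.one e = i then (μ e : ℂ) * (p.1 (o.zero e) * (z * 0) + p.2 e * ε) else 0) := by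
        rw [← Finset.sum_sub_distrib, Finset.mul_sum]
        refine Finset.sum_congr rfl fun e _ => ?_
        have h3 : (Bᵀ * D) i e = B e i * μ e := Matrix.mul_diagonal _ _ _ _
        change (Bᵀ * D) i e * p.2 e = _
        rw [h3, hB, coboundary]
        split_ifs
        · linear_combination (μ e * p.2 e : ℂ) * hε
        · ring
        · linear_combination (μ e * p.2 e : ℂ) * hε
        · ring
      have hε0 : ε ≠ 0 := by rintro rfl; simp at hε
      rw [h2, Pi.zero_apply, mul_eq_zero, sub_eq_zero, or_iff_right hε0]
  let E : ((LinearMap.ker B.mulVecLin).prod (LinearMap.ker (Bᵀ * D).mulVecLin)) ≃ₗ[ℂ]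
      LinearMap.ker B.mulVecLin × LinearMap.ker (Bᵀ * D).mulVecLin :=
    { toFun := fun p => (⟨p.1.1, p.2.1⟩, ⟨p.1.2, p.2.2⟩)
      invFun := fun p => ⟨(p.1.1, p.2.1), ⟨p.1.2, p.2.2⟩⟩
      map_add' := fun _ _ => rfl
      map_smul' := fun _ _ => rfl
      left_inv := fun _ => rfl
      right_inv := fun _ => rfl }
  have r1 := LinearMap.finrank_range_add_finrank_ker B.mulVecLin
  have r2 := LinearMap.finrank_range_add_finrank_ker (Bᵀ * D).mulVecLin
  have r3 : (Bᵀ * D).rank = B.rank := by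
    rw [Matrix.rank_mul_eq_left_of_det_ne_zero _ _ hDet, Matrix.rank_transpose]
  rw [Matrix.rank, Matrix.rank] at r3
  rw [Module.finrank_fintype_fun_eq_card] at r1 r2
  rw [h1, E.finrank_eq, Module.finrank_prod]
  omega

end VertexSystem

end EdgeParam

/-! ### The equation `u'' = z u` -/

/-- `C` and `S` solve `u'' = z u` with initial data `C 0 = 1`, `C' 0 = 0`, `S 0 = 0`, `S' 0 = 1`. -/
structure IsFundamentalPair (z : ℂ) (C S : ℝ → ℂ) : Prop where
  hasDerivAt_left : ∀ x, HasDerivAt C (z * S x) x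
  hasDerivAt_right : ∀ x, HasDerivAt S (C x) x
  left_zero : C 0 = 1
  right_zero : S 0 = 0

namespace IsFundamentalPair

variable {z : ℂ} {C S : ℝ → ℂ} (h : IsFundamentalPair z C S)
include h

theorem continuous_left : Continuous C :=
  continuous_iff_continuousAt.2 fun x => (h.hasDerivAt_left x).continuousAt

theorem continuous_right : Continuous S :=
  continuous_iff_continuousAt.2 fun x => (h.hasDerivAt_right x).continuousAt

theorem isPrimitive_left : IsPrimitive C (fun x => z * S x) :=
  .of_hasDerivAt h.hasDerivAt_left (continuous_const.mul h.continuous_right)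

theorem isPrimitive_right : IsPrimitive S C :=
  .of_hasDerivAt h.hasDerivAt_right h.continuous_left

/-- The Wronskian of `C` and `S`, which has zero derivative. -/
theorem sq_sub (x : ℝ) : C x ^ 2 - z * S x ^ 2 = 1 := by
  have hd : ∀ x, HasDerivAt (fun x => C x ^ 2 - z * S x ^ 2) 0 x := fun x =>
    (((h.hasDerivAt_left x).pow 2).sub (((h.hasDerivAt_right x).pow 2).const_mul z)).congr_deriv
      (by push_cast; ring)
  have := is_const_of_deriv_eq_zero (fun x => (hd x).differentiableAt) (fun x => (hd x).deriv) x 0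
  simpa [h.left_zero, h.right_zero] using this

end IsFundamentalPair

/-- The pair is `cos (w x)`, `sin (w x) / w`, degenerating to `1`, `x` at `w = 0`, where `w * S 1 =
sin w` does not determine `S 1`. -/
theorem exists_isFundamentalPair (w : ℂ) : ∃ C S : ℝ → ℂ, IsFundamentalPair (-w ^ 2) C S ∧
    C 1 = Complex.cos w ∧ (w = 0 → S 1 = 1) ∧ w * S 1 = Complex.sin w := by
  rcases eq_or_ne w 0 with rfl | hw
  · refine ⟨fun _ => 1, fun x => x, ⟨fun x => ?_, fun x => ?_, rfl, by simp⟩, by simp, by simp,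
      by simp⟩
    · simpa using hasDerivAt_const x (1 : ℂ)
    · exact (hasDerivAt_id x).ofReal_comp
  · have hl : ∀ x : ℝ, HasDerivAt (fun x : ℝ => w * (x : ℂ)) w x := fun x => by
      simpa using ((hasDerivAt_id x).ofReal_comp).const_mul w
    refine ⟨fun x => Complex.cos (w * x), fun x => Complex.sin (w * x) / w,
      ⟨fun x => ?_, fun x => ?_, by simp, by simp⟩, by simp, fun h => absurd h hw, ?_⟩
    · refine ((Complex.hasDerivAt_cos _).comp x (hl x)).congr_deriv ?_
      field_simp
    · refine (((Complex.hasDerivAt_sin _).comp x (hl x)).div_const w).congr_deriv ?_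
      field_simp
    · simp only [Complex.ofReal_one, mul_one]
      field_simp

namespace IsPrimitive

variable {u v f : ℝ → ℂ} {z : ℂ} {C S : ℝ → ℂ}

theorem congr_deriv {g g' : ℝ → ℂ} (h : IsPrimitive f g) (hg : ∀ x, g x = g' x) :
    IsPrimitive f g' := (funext hg : g = g') ▸ h

theorem eq_of_deriv_zero (h : IsPrimitive f fun _ => 0) {x : ℝ} (hx : x ∈ Icc (0 : ℝ) 1) :
    f x = f 0 := by
  simpa using h.eq_add_integral x hx

theorem const_mul (a : ℂ) {g : ℝ → ℂ} (h : IsPrimitive f g) :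
    IsPrimitive (fun x => a * f x) (fun x => a * g x) := by
  refine ((of_hasDerivAt (fun x => hasDerivAt_const x a) continuous_const).mul h).congr_deriv ?_
  intro x
  simp

/-- Both `u C - v S` and `v C - z u S` have zero derivative, so they equal `u 0` and `v 0`; the
Wronskian identity inverts this linear system. -/
theorem eq_fundamental (hCS : IsFundamentalPair z C S) (huv : IsPrimitive u v)
    (hv : IsPrimitive v fun x => z * u x) {x : ℝ} (hx : x ∈ Icc (0 : ℝ) 1) :
    u x = u 0 * C x + v 0 * S x ∧ v x = u 0 * (z * S x) + v 0 * C x := by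
  have hC := hCS.isPrimitive_left
  have hS := hCS.isPrimitive_right
  have p := (((huv.mul hC).sub (hv.mul hS)).congr_deriv (g' := fun _ => 0)
    fun x => by ring).eq_of_deriv_zero hx
  have q := (((hv.mul hC).sub (huv.mul (hS.const_mul z))).congr_deriv (g' := fun _ => 0)
    fun x => by ring).eq_of_deriv_zero hx
  simp only [hCS.left_zero, hCS.right_zero] at p q
  have w := hCS.sq_sub x
  constructor
  · linear_combination C x * p + S x * q - u x * w
  · linear_combination z * S x * p + C x * q - v x * w

theorem fundamental (hCS : IsFundamentalPair z C S) (a b : ℂ) :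
    IsPrimitive (fun x => a * C x + b * S x) (fun x => a * (z * S x) + b * C x) :=
  (hCS.isPrimitive_left.const_mul a).add (hCS.isPrimitive_right.const_mul b)

theorem fundamental_deriv (hCS : IsFundamentalPair z C S) (a b : ℂ) :
    IsPrimitive (fun x => a * (z * S x) + b * C x) (fun x => z * (a * C x + b * S x)) :=
  (((hCS.isPrimitive_right.const_mul z).const_mul a).add
    (hCS.isPrimitive_left.const_mul b)).congr_deriv fun x => by ring

/-- Variation of constants. -/
theorem exists_particular (hCS : IsFundamentalPair z C S) {g : ℝ → ℂ}
    (hg : IntegrableOn g (Ioo 0 1)) : ∃ u v : ℝ → ℂ, IsPrimitive u v ∧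
      IsPrimitive v (fun x => z * u x - g x) ∧ u 0 = 0 ∧ v 0 = 0 := by
  have iS : IntegrableOn (fun x => g x * S x) (Ioo 0 1) :=
    integrable_mul_continuousOn hg hCS.continuous_right.continuousOn
  have iC : IntegrableOn (fun x => g x * C x) (Ioo 0 1) :=
    integrable_mul_continuousOn hg hCS.continuous_left.continuousOn
  have hα : IsPrimitive (fun x => ∫ t in (0 : ℝ)..x, g t * S t) (fun x => g x * S x) :=
    ⟨iS, by simp⟩
  have hβ : IsPrimitive (fun x => ∫ t in (0 : ℝ)..x, g t * C t) (fun x => g x * C x) :=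
    ⟨iC, by simp⟩
  have hC := hCS.isPrimitive_left
  have hS := hCS.isPrimitive_right
  -- With `α = ∫ g S` and `β = ∫ g C`, take `u = α C - β S`. The terms in `g` cancel in `u'`; in the
  -- derivative of `v` they leave `g (z S² - C²) = -g`.
  refine ⟨_, _, ((hα.mul hC).sub (hβ.mul hS)).congr_deriv fun x => ?_,
    ((hα.mul (hS.const_mul z)).sub (hβ.mul hC)).congr_deriv fun x => ?_, by simp, by simp⟩
  · ring
  · linear_combination -(g x) * hCS.sq_sub x

end IsPrimitive

/-! ### The network operator -/

theorem ae_edgeMeasure {μ : ℝ} (hμ : 0 < μ) :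
    ae (edgeMeasure μ) = ae (volume.restrict (Ioo 0 1)) := by
  ext s
  exact Measure.ae_ennreal_smul_measure_iff (by simpa using hμ) (p := (· ∈ s))

theorem memLp_edgeMeasure_iff {μ : ℝ} (hμ : 0 < μ) {f : ℝ → ℂ} :
    MemLp f 2 (edgeMeasure μ) ↔ MemLp f 2 (volume.restrict (Ioo 0 1)) := by
  refine ⟨fun h => ?_, fun h => h.smul_measure (by simp)⟩
  have := h.smul_measure (c := (ENNReal.ofReal μ)⁻¹) (by simpa using hμ)
  rwa [edgeMeasure, smul_smul, ENNReal.inv_mul_cancel (by simpa using hμ) (by simp), one_smul]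
    at this

theorem integral_edgeMeasure {μ : ℝ} (hμ : 0 < μ) (f : ℝ → ℂ) :
    ∫ x, f x ∂edgeMeasure μ = μ * ∫ x in Ioo (0 : ℝ) 1, f x := by
  rw [edgeMeasure, integral_smul_measure, ENNReal.toReal_ofReal hμ.le, Complex.real_smul]

theorem ContinuousOn.memLp_edgeMeasure {μ : ℝ} (hμ : 0 < μ) {f : ℝ → ℂ}
    (hf : ContinuousOn f (Icc 0 1)) : MemLp f 2 (edgeMeasure μ) := by
  rw [memLp_edgeMeasure_iff hμ]
  obtain ⟨K, hK⟩ := isCompact_Icc.exists_bound_of_continuousOn hf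
  refine MemLp.of_bound ((hf.mono Ioo_subset_Icc_self).aestronglyMeasurable measurableSet_Ioo) K ?_
  exact (ae_restrict_iff' measurableSet_Ioo).2
    (Filter.Eventually.of_forall fun x hx => hK x (Ioo_subset_Icc_self hx))

theorem EdgeParam.sum_mul_comp {V : Type*} [Fintype V] [DecidableEq V] {G : SimpleGraph V}
    [Fintype G.edgeSet] (t : G.edgeSet → V) (y : G.edgeSet → ℂ) (d : V → ℂ) :
    ∑ e, d (t e) * y e = ∑ i, d i * ∑ e, if t e = i then y e else 0 := by
  simp only [Finset.mul_sum]
  rw [Finset.sum_comm]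
  simp

section Operator

variable {V : Type*} [Fintype V] [DecidableEq V] {G : SimpleGraph V} [Fintype G.edgeSet]
  (o : EdgeParam G) {μ : G.edgeSet → ℝ}

theorem mem_networkGraph_iff (hμ : ∀ e, 0 < μ e) (p : X2 μ × X2 μ) :
    p ∈ networkGraph o (fun _ => 1) μ ↔ ∃ u v w : G.edgeSet → ℝ → ℂ, ∃ d : V → ℂ,
      (∀ e, IsPrimitive (u e) (v e)) ∧ (∀ e, IsPrimitive (v e) (w e)) ∧
      (∀ e, p.1 e =ᵐ[volume.restrict (Ioo 0 1)] u e) ∧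
      (∀ e, p.2 e =ᵐ[volume.restrict (Ioo 0 1)] w e) ∧
      (∀ i, (∑ e, if o.zero e = i then (μ e : ℂ) * v e 0 else 0) =
        ∑ e, if o.one e = i then (μ e : ℂ) * v e 1 else 0) ∧
      (∀ e, d (o.zero e) = u e 0) ∧ ∀ e, d (o.one e) = u e 1 := by
  have kir : ∀ v : G.edgeSet → ℝ → ℂ,
      o.wIncPlus (fun _ => 1) μ *ᵥ (fun e => v e 0) =
        o.wIncMinus (fun _ => 1) μ *ᵥ (fun e => v e 1) ↔
      ∀ i, (∑ e, if o.zero e = i then (μ e : ℂ) * v e 0 else 0) =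
        ∑ e, if o.one e = i then (μ e : ℂ) * v e 1 else 0 := by
    intro v
    rw [funext_iff]
    refine forall_congr' fun i => ?_
    simp [Matrix.mulVec, dotProduct, EdgeParam.wIncPlus, EdgeParam.wIncMinus]
  have vert : ∀ (u : G.edgeSet → ℝ → ℂ) (d : V → ℂ),
      (o.incPlusᵀ *ᵥ d = (fun e => u e 0) ∧ o.incMinusᵀ *ᵥ d = fun e => u e 1) ↔
      (∀ e, d (o.zero e) = u e 0) ∧ ∀ e, d (o.one e) = u e 1 := by
    intro u d
    simp [funext_iff, Matrix.mulVec, dotProduct, EdgeParam.incPlus, EdgeParam.incMinus]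
  constructor
  · rintro ⟨u, v, w, h, h1, h2, hk, d, hd⟩
    refine ⟨u, v, w, d, fun e => (isH2_iff.1 (h e)).1, fun e => (isH2_iff.1 (h e)).2.1, fun e => ?_,
      fun e => ?_, (kir v).1 hk, (vert u d).1 hd⟩
    · simpa only [Filter.EventuallyEq, ae_edgeMeasure (hμ e)] using h1 e
    · simpa only [Filter.EventuallyEq, ae_edgeMeasure (hμ e), Complex.ofReal_one, one_smul]
        using h2 e
  · rintro ⟨u, v, w, d, huv, hvw, h1, h2, hk, hd⟩
    refine ⟨u, v, w, fun e => isH2_iff.2 ⟨huv e, hvw e, ?_⟩, fun e => ?_, fun e => ?_, (kir v).2 hk,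
      d, (vert u d).2 hd⟩
    · exact ((memLp_edgeMeasure_iff (hμ e)).1 (Lp.memLp (p.2 e))).ae_eq (h2 e)
    · simpa only [Filter.EventuallyEq, ae_edgeMeasure (hμ e)] using h1 e
    · simpa only [Filter.EventuallyEq, ae_edgeMeasure (hμ e), Complex.ofReal_one, one_smul]
        using h2 e

/-- Green's formula leaves only boundary terms on each edge, products of vertex values and fluxes.
Regrouped by vertices they cancel by Kirchhoff's law. Primes mark the data of `y`, not derivatives.
-/
theorem networkOperator_isFormalAdjoint (hμ : ∀ e, 0 < μ e) :
    (networkOperator o (fun _ => 1) μ).IsFormalAdjoint (networkOperator o (fun _ => 1) μ) := by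
  intro x y
  have hx := (networkOperator o (fun _ => 1) μ).mem_graph x
  have hy := (networkOperator o (fun _ => 1) μ).mem_graph y
  rw [networkOperator_graph, mem_networkGraph_iff o hμ] at hx hy
  obtain ⟨u, v, w, d, huv, hvw, h1, h2, hk, hd0, hd1⟩ := hx
  obtain ⟨u', v', w', d', huv', hvw', h1', h2', hk', hd0', hd1'⟩ := hy
  simp only at h1 h2 h1' h2'
  rw [PiLp.inner_apply, PiLp.inner_apply, ← sub_eq_zero, ← Finset.sum_sub_distrib]
  have edge : ∀ e, (inner ℂ (networkOperator o (fun _ => 1) μ x e) ((y : X2 μ) e) -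
      inner ℂ ((x : X2 μ) e) (networkOperator o (fun _ => 1) μ y e) : ℂ) =
      (d' (o.one e) * (starRingEnd ℂ (μ e * v e 1)) - d' (o.zero e) * starRingEnd ℂ (μ e * v e 0)) -
      (starRingEnd ℂ (d (o.one e)) * (μ e * v' e 1) -
        starRingEnd ℂ (d (o.zero e)) * (μ e * v' e 0)) := by
    intro e
    have p1 := (huv' e).mul (hvw e).conj
    have p2 := (hvw' e).mul (huv e).conj
    have p := ((p1.sub p2).congr_deriv (g' := fun x =>
      u' e x * starRingEnd ℂ (w e x) - w' e x * starRingEnd ℂ (u e x)) fun x => by ring).integral_eq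
    have int1 : Integrable (fun x => u' e x * starRingEnd ℂ (w e x))
        (volume.restrict (Ioo 0 1)) := by
      simp only [mul_comm (u' e _)]
      exact IsPrimitive.integrable_mul_continuousOn (hvw e).conj.integrable (huv' e).continuousOn
    have int2 : Integrable (fun x => w' e x * starRingEnd ℂ (u e x))
        (volume.restrict (Ioo 0 1)) :=
      IsPrimitive.integrable_mul_continuousOn (hvw' e).integrable (huv e).conj.continuousOn
    rw [integral_sub int1 int2] at p
    have q1 : inner ℂ (networkOperator o (fun _ => 1) μ x e) ((y : X2 μ) e) =
        (μ e : ℂ) * ∫ x in Ioo (0 : ℝ) 1, u' e x * starRingEnd ℂ (w e x) := by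
      rw [L2.inner_def, integral_edgeMeasure (hμ e)]
      congr 1
      refine integral_congr_ae ?_
      filter_upwards [h2 e, h1' e] with t ht ht'
      rw [ht, ht', RCLike.inner_apply]
    have q2 : inner ℂ ((x : X2 μ) e) (networkOperator o (fun _ => 1) μ y e) =
        (μ e : ℂ) * ∫ x in Ioo (0 : ℝ) 1, w' e x * starRingEnd ℂ (u e x) := by
      rw [L2.inner_def, integral_edgeMeasure (hμ e)]
      congr 1
      refine integral_congr_ae ?_
      filter_upwards [h1 e, h2' e] with t ht ht'
      rw [ht, ht', RCLike.inner_apply]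
    rw [q1, q2, ← mul_sub, p, hd0, hd0', hd1, hd1']
    simp only [map_mul, Complex.conj_ofReal]
    ring
  rw [Finset.sum_congr rfl fun e _ => edge e]
  simp only [Finset.sum_sub_distrib]
  have hkc : ∀ i, (∑ e, if o.zero e = i then starRingEnd ℂ (μ e * v e 0) else 0) =
      ∑ e, if o.one e = i then starRingEnd ℂ (μ e * v e 1) else 0 := by
    intro i
    simpa only [map_sum, apply_ite (starRingEnd ℂ), map_zero] using congrArg (starRingEnd ℂ) (hk i)
  rw [EdgeParam.sum_mul_comp o.one (fun e => starRingEnd ℂ (μ e * v e 1)),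
    EdgeParam.sum_mul_comp o.zero (fun e => starRingEnd ℂ (μ e * v e 0)),
    EdgeParam.sum_mul_comp o.one (fun e => μ e * v' e 1) (fun i => starRingEnd ℂ (d i)),
    EdgeParam.sum_mul_comp o.zero (fun e => μ e * v' e 0) (fun i => starRingEnd ℂ (d i))]
  simp only [hkc, hk']
  ring

end Operator

/-! ### Eigenspaces as kernels of the vertex system, and the resolvent. -/

section Spectrum

variable {V : Type*} [Fintype V] [DecidableEq V] {G : SimpleGraph V} [Fintype G.edgeSet]
  (o : EdgeParam G) {μ : G.edgeSet → ℝ}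

theorem mem_eigenspace_networkOperator_iff (hμ : ∀ e, 0 < μ e) {z : ℂ} {C S : ℝ → ℂ}
    (hCS : IsFundamentalPair z C S) (f : X2 μ) :
    f ∈ UnboundedOp.eigenspace (networkOperator o (fun _ => 1) μ) z ↔
      ∃ p ∈ LinearMap.ker (o.vertexSystem μ z (C 1) (S 1)), ∀ e,
        f e =ᵐ[volume.restrict (Ioo 0 1)] fun x => p.1 (o.zero e) * C x + p.2 e * S x := by
  have hg : f ∈ UnboundedOp.eigenspace (networkOperator o (fun _ => 1) μ) z ↔
      (f, z • f) ∈ networkGraph o (fun _ => 1) μ := by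
    rw [UnboundedOp.mem_eigenspace, ← networkOperator_graph, LinearPMap.mem_graph_iff]
    exact ⟨fun ⟨h, h'⟩ => ⟨⟨f, h⟩, rfl, h'⟩, fun ⟨x, h, h'⟩ => by
      subst h
      exact ⟨x.2, h'⟩⟩
  have hz : ∀ e, (z • f) e =ᵐ[volume.restrict (Ioo 0 1)] fun x => z * f e x := by
    intro e
    rw [Filter.EventuallyEq, ← ae_edgeMeasure (hμ e)]
    exact Lp.coeFn_smul z (f e)
  rw [hg, mem_networkGraph_iff o hμ]
  constructor
  · rintro ⟨u, v, w, d, huv, hvw, h1, h2, hk, hd0, hd1⟩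
    have hv : ∀ e, IsPrimitive (v e) fun x => z * u e x := by
      intro e
      refine (hvw e).congr_right ?_
      filter_upwards [h1 e, h2 e, hz e] with x a b c
      rw [← b, ← a]
      exact c
    have hm : (1 : ℝ) ∈ Icc (0 : ℝ) 1 := by simp
    refine ⟨(d, fun e => v e 0), ?_, fun e => ?_⟩
    · rw [EdgeParam.mem_ker_vertexSystem_iff]
      refine ⟨fun e => ?_, fun i => ?_⟩
      · simp only [hd0, hd1, ((huv e).eq_fundamental hCS (hv e) hm).1]
      · rw [hk i]
        refine Finset.sum_congr rfl fun e _ => ?_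
        simp only [hd0, ((huv e).eq_fundamental hCS (hv e) hm).2]
    · filter_upwards [h1 e, ae_restrict_mem measurableSet_Ioo] with x a hx
      rw [a, ((huv e).eq_fundamental hCS (hv e) (Ioo_subset_Icc_self hx)).1, hd0]
  · rintro ⟨⟨d, b⟩, hp, hf⟩
    rw [EdgeParam.mem_ker_vertexSystem_iff] at hp
    refine ⟨_, _, _, d, fun e => IsPrimitive.fundamental hCS (d (o.zero e)) (b e),
      fun e => IsPrimitive.fundamental_deriv hCS (d (o.zero e)) (b e), hf, fun e => ?_, fun i => ?_,
      fun e => ?_, fun e => ?_⟩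
    · filter_upwards [hf e, hz e] with x a c
      exact c.trans (by rw [a])
    · simpa [hCS.left_zero, hCS.right_zero] using hp.2 i
    · simp [hCS.left_zero, hCS.right_zero]
    · exact (hp.1 e).symm

/-- The element of `X₂` with restriction `p.1 (zero e) * C + p.2 e * S` to the edge `e`. -/
noncomputable def fundamentalMap (hμ : ∀ e, 0 < μ e) {C S : ℝ → ℂ} (hC : Continuous C)
    (hS : Continuous S) : ((V → ℂ) × (G.edgeSet → ℂ)) →ₗ[ℂ] X2 μ where
  toFun p := WithLp.toLp 2 fun e =>
    p.1 (o.zero e) • (hC.continuousOn.memLp_edgeMeasure (hμ e)).toLp C +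
      p.2 e • (hS.continuousOn.memLp_edgeMeasure (hμ e)).toLp S
  map_add' p q := by
    ext e : 1
    simp only [Prod.fst_add, Prod.snd_add, Pi.add_apply, PiLp.add_apply]
    module
  map_smul' a p := by
    ext e : 1
    simp only [Prod.smul_fst, Prod.smul_snd, Pi.smul_apply, smul_eq_mul, PiLp.smul_apply,
      RingHom.id_apply]
    module

omit [Fintype V] [DecidableEq V] [Fintype G.edgeSet] in
theorem fundamentalMap_ae_eq (hμ : ∀ e, 0 < μ e) {C S : ℝ → ℂ} (hC : Continuous C)
    (hS : Continuous S) (p : (V → ℂ) × (G.edgeSet → ℂ)) (e : G.edgeSet) :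
    fundamentalMap o hμ hC hS p e =ᵐ[volume.restrict (Ioo 0 1)]
      fun x => p.1 (o.zero e) * C x + p.2 e * S x := by
  rw [Filter.EventuallyEq, ← ae_edgeMeasure (hμ e)]
  have mC := hC.continuousOn.memLp_edgeMeasure (hμ e)
  have mS := hS.continuousOn.memLp_edgeMeasure (hμ e)
  filter_upwards [Lp.coeFn_add (p.1 (o.zero e) • mC.toLp C) (p.2 e • mS.toLp S),
    Lp.coeFn_smul (p.1 (o.zero e)) (mC.toLp C), Lp.coeFn_smul (p.2 e) (mS.toLp S),
    mC.coeFn_toLp, mS.coeFn_toLp] with x a b c d f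
  refine a.trans ?_
  rw [Pi.add_apply, b, c, Pi.smul_apply, Pi.smul_apply, d, f, smul_eq_mul, smul_eq_mul]

/-- The difference vanishes a.e., hence so does its derivative; both are continuous, and their
values at `0` are `a - a'` and `b - b'`. -/
theorem eq_of_fundamental_ae_eq {z : ℂ} {C S : ℝ → ℂ} (hCS : IsFundamentalPair z C S)
    {a b a' b' : ℂ} (h : (fun x => a * C x + b * S x) =ᵐ[volume.restrict (Ioo 0 1)]
      fun x => a' * C x + b' * S x) : a = a' ∧ b = b' := by
  have p := IsPrimitive.fundamental hCS (a - a') (b - b')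
  have hu : (fun x => (a - a') * C x + (b - b') * S x) =ᵐ[volume.restrict (Ioo 0 1)] 0 := by
    filter_upwards [h] with x hx
    rw [Pi.zero_apply]
    linear_combination hx
  have hv := p.isWeakDeriv.ae_eq_zero hu
  have m0 : (0 : ℝ) ∈ Icc (0 : ℝ) 1 := by simp
  have ev : ∀ {f : ℝ → ℂ}, f =ᵐ[volume.restrict (Ioo 0 1)] 0 → ContinuousOn f (Icc 0 1) →
      f 0 = 0 := by
    intro f hf hc
    rw [restrict_Ioo_eq_restrict_Icc] at hf
    exact Measure.eqOn_Icc_of_ae_eq volume zero_ne_one hf hc continuousOn_const m0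
  have e1 := ev hu p.continuousOn
  have e2 := ev hv (IsPrimitive.fundamental_deriv hCS _ _).continuousOn
  simp only [hCS.left_zero, hCS.right_zero, mul_one, mul_zero, add_zero, zero_add] at e1 e2
  exact ⟨sub_eq_zero.1 e1, sub_eq_zero.1 e2⟩

theorem nonempty_eigenspace_equiv (hμ : ∀ e, 0 < μ e) (hG : ∀ i, ∃ k, G.Adj i k) {z : ℂ}
    {C S : ℝ → ℂ} (hCS : IsFundamentalPair z C S) :
    Nonempty (LinearMap.ker (o.vertexSystem μ z (C 1) (S 1)) ≃ₗ[ℂ]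
      UnboundedOp.eigenspace (networkOperator o (fun _ => 1) μ) z) := by
  set K := LinearMap.ker (o.vertexSystem μ z (C 1) (S 1))
  let F : K →ₗ[ℂ] X2 μ :=
    (fundamentalMap o hμ hCS.continuous_left hCS.continuous_right).comp K.subtype
  have hF : Function.Injective F := by
    intro p q h
    have he : ∀ e, p.1.1 (o.zero e) = q.1.1 (o.zero e) ∧ p.1.2 e = q.1.2 e := by
      intro e
      refine eq_of_fundamental_ae_eq hCS ?_
      have h1 := fundamentalMap_ae_eq o hμ hCS.continuous_left hCS.continuous_right p.1 e
      have h2 := fundamentalMap_ae_eq o hμ hCS.continuous_left hCS.continuous_right q.1 e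
      have h3 : fundamentalMap o hμ hCS.continuous_left hCS.continuous_right p.1 =
        fundamentalMap o hμ hCS.continuous_left hCS.continuous_right q.1 := h
      rw [h3] at h1
      exact h1.symm.trans h2
    have hp := ((o.mem_ker_vertexSystem_iff μ z (C 1) (S 1) _).1 p.2).1
    have hq := ((o.mem_ker_vertexSystem_iff μ z (C 1) (S 1) _).1 q.2).1
    refine Subtype.ext (Prod.ext (funext fun i => ?_) (funext fun e => (he e).2))
    -- The function on an edge shows directly only the value at `e(0)`; at a vertex reached as
    -- `e(1)` the continuity equation supplies the value.
    obtain ⟨k, hk⟩ := hG i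
    obtain ⟨e, ⟨rfl, -⟩ | ⟨-, rfl⟩⟩ := o.exists_edge hk
    · exact (he e).1
    · rw [← hp e, ← hq e, (he e).1, (he e).2]
  have hrange : LinearMap.range F =
      UnboundedOp.eigenspace (networkOperator o (fun _ => 1) μ) z := by
    ext f
    rw [mem_eigenspace_networkOperator_iff o hμ hCS, LinearMap.mem_range]
    constructor
    · rintro ⟨p, rfl⟩
      exact ⟨p.1, p.2, fun e =>
        fundamentalMap_ae_eq o hμ hCS.continuous_left hCS.continuous_right p.1 e⟩
    · rintro ⟨p, hp, hf⟩
      refine ⟨⟨p, hp⟩, ?_⟩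
      ext e : 1
      refine Lp.ext ?_
      rw [Filter.EventuallyEq, ae_edgeMeasure (hμ e)]
      exact (fundamentalMap_ae_eq o hμ hCS.continuous_left hCS.continuous_right p e).trans (hf e).symm
  exact ⟨(LinearEquiv.ofInjective F hF).trans (LinearEquiv.ofEq _ _ hrange)⟩

theorem geomMult_networkOperator (hμ : ∀ e, 0 < μ e) (hG : ∀ i, ∃ k, G.Adj i k) {z : ℂ}
    {C S : ℝ → ℂ} (hCS : IsFundamentalPair z C S) :
    UnboundedOp.geomMult (networkOperator o (fun _ => 1) μ) z =
      Module.finrank ℂ (LinearMap.ker (o.vertexSystem μ z (C 1) (S 1))) := by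
  obtain ⟨E⟩ := nonempty_eigenspace_equiv o hμ hG hCS
  have : FiniteDimensional ℂ (UnboundedOp.eigenspace (networkOperator o (fun _ => 1) μ) z) :=
    E.finiteDimensional
  rw [UnboundedOp.geomMult, E.finrank_eq, ← Module.finrank_eq_rank, Cardinal.toENat_nat]

/-- A particular solution on each edge is corrected by a homogeneous one. The vertex system has `n +
m` unknowns and equations, so a trivial kernel makes every correction solvable. -/
theorem surjective_sub_networkOperator (hμ : ∀ e, 0 < μ e) {z : ℂ} {C S : ℝ → ℂ}
    (hCS : IsFundamentalPair z C S) (hK : LinearMap.ker (o.vertexSystem μ z (C 1) (S 1)) = ⊥)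
    (g : X2 μ) : ∃ f : (networkOperator o (fun _ => 1) μ).domain,
      z • (f : X2 μ) - networkOperator o (fun _ => 1) μ f = g := by
  have hgi : ∀ e, IntegrableOn (g e) (Ioo 0 1) := fun e =>
    ((memLp_edgeMeasure_iff (hμ e)).1 (Lp.memLp (g e))).integrable (by norm_num)
  choose u v huv hv hu0 hv0 using fun e => IsPrimitive.exists_particular hCS (hgi e)
  have hsurj : Function.Surjective (o.vertexSystem μ z (C 1) (S 1)) := by
    refine (LinearMap.injective_iff_surjective_of_finrank_eq_finrank ?_).1
      (LinearMap.ker_eq_bot.1 hK)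
    rw [Module.finrank_prod, Module.finrank_prod, add_comm]
  -- The particular solution has zero data at `0`, so only its value and flux at `1` need
  -- compensation.
  obtain ⟨⟨d, b⟩, hp⟩ := hsurj
    (fun e => -u e 1, fun i => ∑ e, if o.one e = i then (μ e : ℂ) * v e 1 else 0)
  obtain ⟨hp1, hp2⟩ := Prod.ext_iff.1 hp
  simp only [EdgeParam.vertexSystem, LinearMap.coe_mk, AddHom.coe_mk, funext_iff] at hp1 hp2
  have hu : ∀ e, IsPrimitive (fun x => u e x + (d (o.zero e) * C x + b e * S x))
      (fun x => v e x + (d (o.zero e) * (z * S x) + b e * C x)) := fun e =>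
    (huv e).add (.fundamental hCS _ _)
  have hv' : ∀ e, IsPrimitive (fun x => v e x + (d (o.zero e) * (z * S x) + b e * C x))
      (fun x => z * (u e x + (d (o.zero e) * C x + b e * S x)) - g e x) := fun e =>
    ((hv e).add (.fundamental_deriv hCS _ _)).congr_deriv fun x => by ring
  let f : X2 μ := WithLp.toLp 2 fun e => ((hu e).continuousOn.memLp_edgeMeasure (hμ e)).toLp _
  have hf : ∀ e, f e =ᵐ[volume.restrict (Ioo 0 1)]
      fun x => u e x + (d (o.zero e) * C x + b e * S x) := by
    intro e
    rw [Filter.EventuallyEq, ← ae_edgeMeasure (hμ e)]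
    exact MemLp.coeFn_toLp ((hu e).continuousOn.memLp_edgeMeasure (hμ e))
  have hmem : (f, z • f - g) ∈ networkGraph o (fun _ => 1) μ := by
    rw [mem_networkGraph_iff o hμ]
    refine ⟨_, _, _, d, hu, hv', hf, fun e => ?_, fun i => ?_, fun e => ?_, fun e => ?_⟩
    · have a := Lp.coeFn_sub ((z • f) e) (g e)
      have a' := Lp.coeFn_smul z (f e)
      rw [Filter.EventuallyEq, ae_edgeMeasure (hμ e)] at a a'
      filter_upwards [a, a', hf e] with x h1 h2 h3
      refine h1.trans ?_
      rw [Pi.sub_apply, ← h3]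
      congr 1
    · have := hp2 i
      rw [sub_eq_iff_eq_add, ← Finset.sum_add_distrib] at this
      simp only [hv0, hCS.left_zero, hCS.right_zero, mul_one, mul_zero, zero_add]
      rw [this]
      refine Finset.sum_congr rfl fun e _ => ?_
      split_ifs <;> ring
    · simp [hu0, hCS.left_zero, hCS.right_zero]
    · linear_combination -hp1 e
  rw [← networkOperator_graph, LinearPMap.mem_graph_iff] at hmem
  obtain ⟨x, hx, hx'⟩ := hmem
  refine ⟨x, ?_⟩
  rw [hx', hx]
  exact sub_sub_cancel _ _

theorem mem_spectrum_networkOperator_iff (hμ : ∀ e, 0 < μ e) (hG : ∀ i, ∃ k, G.Adj i k)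
    (z : ℂ) : z ∈ UnboundedOp.spectrum (networkOperator o (fun _ => 1) μ) ↔
      UnboundedOp.geomMult (networkOperator o (fun _ => 1) μ) z ≠ 0 := by
  obtain ⟨w, hw⟩ := IsAlgClosed.exists_pow_nat_eq (-z) two_pos
  obtain ⟨C, S, hCS, -⟩ := exists_isFundamentalPair w
  rw [hw, neg_neg] at hCS
  rw [geomMult_networkOperator o hμ hG hCS, Nat.cast_ne_zero]
  have hA := networkOperator_isFormalAdjoint o hμ
  obtain ⟨E⟩ := nonempty_eigenspace_equiv o hμ hG hCS
  have : FiniteDimensional ℂ (UnboundedOp.eigenspace (networkOperator o (fun _ => 1) μ) z) :=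
    E.finiteDimensional
  constructor
  · intro hz h0
    rw [Submodule.finrank_eq_zero] at h0
    have hb : UnboundedOp.eigenspace (networkOperator o (fun _ => 1) μ) z = ⊥ := by
      rw [← Submodule.finrank_eq_zero, ← E.finrank_eq, h0, finrank_bot]
    refine hz (UnboundedOp.mem_resolventSet_of_surjective hA hb
      (surjective_sub_networkOperator o hμ hCS h0) ?_)
    obtain ⟨w, hw⟩ := IsAlgClosed.exists_pow_nat_eq (-starRingEnd ℂ z) two_pos
    obtain ⟨C', S', hCS', -⟩ := exists_isFundamentalPair w
    rw [hw, neg_neg] at hCS'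
    obtain ⟨E'⟩ := nonempty_eigenspace_equiv o hμ hG hCS'
    -- An eigenvalue `conj z` would be real, hence equal to `z`, which is not an eigenvalue.
    have hb' : UnboundedOp.eigenspace (networkOperator o (fun _ => 1) μ) (starRingEnd ℂ z) = ⊥ := by
      rw [Submodule.eq_bot_iff]
      intro f hf
      by_contra hf0
      have := UnboundedOp.conj_eq_of_mem_eigenspace hA hf hf0
      rw [Complex.conj_conj] at this
      rw [← this, hb, Submodule.mem_bot] at hf
      exact hf0 hf
    refine surjective_sub_networkOperator o hμ hCS' ?_
    rw [← Submodule.finrank_eq_zero, E'.finrank_eq, hb', finrank_bot]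
  · intro h
    refine UnboundedOp.mem_spectrum_of_eigenspace_ne_bot fun hb => h ?_
    rw [E.finrank_eq, hb, finrank_bot]

end Spectrum

/-! ### Spectrum and multiplicities -/

section Multiplicity

variable {V : Type*} [Fintype V] [DecidableEq V] {G : SimpleGraph V} [DecidableRel G.Adj]
  [Fintype G.edgeSet] (o : EdgeParam G) {μ : G.edgeSet → ℝ}

/-- The condition on `w` is exactly `S 1 ≠ 0`; it includes `w = 0`, where `S 1 = 1` although `sin w
= 0`. -/
theorem geomMult_neg_sq_of_sin_ne_zero (hμ : ∀ e, 0 < μ e) (hG : ∀ i, ∃ k, G.Adj i k) {w : ℂ}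
    (hw : w = 0 ∨ Complex.sin w ≠ 0) :
    UnboundedOp.geomMult (networkOperator o (fun _ => 1) μ) (-w ^ 2) =
      Module.finrank ℂ (LinearMap.ker (Matrix.toLin'
        (Complex.cos w • 1 - (wTransitionMatrix G μ).map ((↑) : ℝ → ℂ)))) := by
  obtain ⟨C, S, hCS, hC, hS0, hS⟩ := exists_isFundamentalPair w
  have hne : S 1 ≠ 0 := by
    rcases hw with hw | hw
    · rw [hS0 hw]
      exact one_ne_zero
    · rw [← hS] at hw
      exact right_ne_zero_of_mul hw
  rw [geomMult_networkOperator o hμ hG hCS,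
    o.finrank_ker_vertexSystem_of_ne_zero hμ hG hne (hCS.sq_sub 1), hC]

omit [DecidableRel G.Adj] in
theorem geomMult_neg_sq_of_sin_eq_zero (hμ : ∀ e, 0 < μ e) (hG : ∀ i, ∃ k, G.Adj i k) {w : ℂ}
    (hw : w ≠ 0) (hs : Complex.sin w = 0) :
    UnboundedOp.geomMult (networkOperator o (fun _ => 1) μ) (-w ^ 2) + Fintype.card V =
      Fintype.card G.edgeSet +
        (2 * Module.finrank ℂ (LinearMap.ker (o.coboundary (Complex.cos w)).mulVecLin) : ℕ) := by
  obtain ⟨C, S, hCS, hC, -, hS⟩ := exists_isFundamentalPair w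
  have h0 : S 1 = 0 := by
    rw [hs, mul_eq_zero] at hS
    exact hS.resolve_left hw
  have hε : Complex.cos w ^ 2 = 1 := by
    rw [← hC]
    simpa [h0] using hCS.sq_sub 1
  rw [geomMult_networkOperator o hμ hG hCS, h0, hC]
  exact_mod_cast o.finrank_ker_vertexSystem_of_eq_zero hμ hε

omit [DecidableRel G.Adj] in
/-- The multiplicity of `-k²π²` for even `k`. -/
theorem geomMult_even (hμ : ∀ e, 0 < μ e) (hG : ∀ i, ∃ k, G.Adj i k) (hc : G.Connected) {l : ℤ}
    (hl : l ≠ 0) :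
    UnboundedOp.geomMult (networkOperator o (fun _ => 1) μ)
      ((-(4 * l ^ 2 * Real.pi ^ 2) : ℝ) : ℂ) + Fintype.card V = Fintype.card G.edgeSet + 2 := by
  have hw : (l * (2 * Real.pi) : ℂ) ≠ 0 := by
    simp [hl, Real.pi_ne_zero]
  have hs : Complex.sin (l * (2 * Real.pi)) = 0 := by
    have := Complex.sin_int_mul_pi (l * 2)
    rwa [Int.cast_mul, Int.cast_ofNat, mul_assoc] at this
  have h := geomMult_neg_sq_of_sin_eq_zero o hμ hG hw hs
  rw [Complex.cos_int_mul_two_pi, o.finrank_ker_coboundary_one hc, mul_one, Nat.cast_ofNat] at h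
  convert h using 3
  push_cast
  ring

omit [DecidableRel G.Adj] in
/-- The multiplicity of `-k²π²` for odd `k`. -/
theorem geomMult_odd (hμ : ∀ e, 0 < μ e) (hG : ∀ i, ∃ k, G.Adj i k) (l : ℤ) :
    UnboundedOp.geomMult (networkOperator o (fun _ => 1) μ)
      ((-((2 * l + 1) ^ 2 * Real.pi ^ 2) : ℝ) : ℂ) + Fintype.card V =
    Fintype.card G.edgeSet +
      (2 * Module.finrank ℂ (LinearMap.ker (o.coboundary (-1)).mulVecLin) : ℕ) := by
  have hw : (l * (2 * Real.pi) + Real.pi : ℂ) ≠ 0 := by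
    have h1 : (l * (2 * Real.pi) + Real.pi : ℂ) = ((2 * l + 1 : ℤ) : ℂ) * Real.pi := by
      push_cast
      ring
    have h2 : (2 * l + 1 : ℤ) ≠ 0 := by omega
    rw [h1]
    exact mul_ne_zero (by exact_mod_cast h2) (by exact_mod_cast Real.pi_ne_zero)
  have hc := Complex.cos_int_mul_two_pi_add_pi l
  have h := geomMult_neg_sq_of_sin_eq_zero o hμ hG hw (Complex.sin_eq_zero_iff_cos_eq.2 (Or.inr hc))
  rw [hc] at h
  convert h using 3
  push_cast
  ring

/-- The numbers `2lπ ± arccos α` are all the real `t` with `cos t = α`, and excluding `α = ±1` means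
`sin t ≠ 0`. -/
theorem mem_sigmaP_iff (o : EdgeParam G) (hμ : ∀ e, 0 < μ e) (hG : ∀ i, ∃ k, G.Adj i k) (z : ℂ) :
    z ∈ sigmaP (wTransitionMatrix G μ) ↔ ∃ t : ℝ, z = -(t : ℂ) ^ 2 ∧ Real.sin t ≠ 0 ∧
      Real.cos t ∈ spectrum ℝ (wTransitionMatrix G μ) := by
  constructor
  · rintro ⟨α, ⟨hα, hne⟩, l, hz⟩
    obtain ⟨r, hr, h1, h2⟩ := exists_real_of_ker_sub_wTransitionMatrix_ne_bot o hμ hG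
      ((Matrix.mem_spectrum_iff_ker_ne_bot _ α).1 hα)
    rw [Complex.ofReal_inj] at hr
    subst hr
    obtain ⟨t, ht, rfl⟩ : ∃ t : ℝ, (t = 2 * l * Real.pi + Real.arccos α ∨
        t = 2 * l * Real.pi - Real.arccos α) ∧ z = -(t : ℂ) ^ 2 := by
      rcases hz with hz | hz
      · exact ⟨_, Or.inl rfl, by rw [hz]; push_cast; rfl⟩
      · exact ⟨_, Or.inr rfl, by rw [hz]; push_cast; rfl⟩
    have hcos : Real.cos t = α := by
      rw [← Real.cos_arccos h1 h2, eq_comm, Real.cos_eq_cos_iff]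
      exact ⟨l, ht⟩
    refine ⟨t, rfl, fun hs => hne ?_, hcos ▸ hα⟩
    rw [Real.sin_eq_zero_iff_cos_eq, hcos] at hs
    simpa [or_comm] using hs
  · rintro ⟨t, rfl, hs, ht⟩
    refine ⟨Real.cos t, ⟨ht, fun h => hs (Real.sin_eq_zero_iff_cos_eq.2 ?_)⟩, ?_⟩
    · simpa [or_comm] using h
    · obtain ⟨l, hl⟩ := Real.cos_eq_cos_iff.1
        (Real.cos_arccos (Real.neg_one_le_cos t) (Real.cos_le_one t))
      refine ⟨l, hl.imp (fun h => ?_) fun h => ?_⟩ <;>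
      · rw [← h]
        push_cast
        rfl

theorem geomMult_zero (hμ : ∀ e, 0 < μ e) (hG : ∀ i, ∃ k, G.Adj i k) (hc : G.Connected) :
    UnboundedOp.geomMult (networkOperator o (fun _ => 1) μ) 0 = 1 := by
  have h := geomMult_neg_sq_of_sin_ne_zero o hμ hG (w := 0) (Or.inl rfl)
  rw [Complex.cos_zero, finrank_ker_one_sub_wTransitionMatrix o hμ hG hc] at h
  simpa using h

theorem geomMult_neg_sq_ofReal (hμ : ∀ e, 0 < μ e) (hG : ∀ i, ∃ k, G.Adj i k) {t : ℝ}
    (ht : Real.sin t ≠ 0) :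
    UnboundedOp.geomMult (networkOperator o (fun _ => 1) μ) (-(t : ℂ) ^ 2) =
      Module.finrank ℝ (LinearMap.ker (Matrix.toLin'
        (Real.cos t • 1 - wTransitionMatrix G μ))) := by
  have e : (Real.cos t • 1 - wTransitionMatrix G μ).map ((↑) : ℝ → ℂ) =
      Complex.cos t • 1 - (wTransitionMatrix G μ).map ((↑) : ℝ → ℂ) := by
    ext i j
    by_cases h : i = j <;> simp [h]
  rw [geomMult_neg_sq_of_sin_ne_zero o hμ hG (Or.inr (by exact_mod_cast ht)),
    ← Matrix.finrank_ker_map_ofReal, e]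

/-- Write `z = -w²` and split on `sin w = 0`. The last alternative keeps the multiplicity condition,
since whether `-k²π²` occurs depends on the graph. -/
theorem mem_spectrum_iff_cases (hμ : ∀ e, 0 < μ e) (hG : ∀ i, ∃ k, G.Adj i k)
    (hc : G.Connected) (z : ℂ) :
    z ∈ UnboundedOp.spectrum (networkOperator o (fun _ => 1) μ) ↔
      z = 0 ∨ z ∈ sigmaP (wTransitionMatrix G μ) ∨
      ∃ k : ℤ, k ≠ 0 ∧ z = ((-(k ^ 2 * Real.pi ^ 2) : ℝ) : ℂ) ∧
        UnboundedOp.geomMult (networkOperator o (fun _ => 1) μ) z ≠ 0 := by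
  rw [mem_spectrum_networkOperator_iff o hμ hG, mem_sigmaP_iff o hμ hG]
  constructor
  · intro hz
    obtain ⟨w, hw⟩ := IsAlgClosed.exists_pow_nat_eq (-z) two_pos
    obtain rfl : z = -w ^ 2 := by rw [hw, neg_neg]
    by_cases hs : Complex.sin w = 0
    · obtain ⟨k, rfl⟩ := Complex.sin_eq_zero_iff.1 hs
      rcases eq_or_ne k 0 with rfl | hk
      · simp
      · refine Or.inr (Or.inr ⟨k, hk, ?_, hz⟩)
        push_cast
        ring
    · refine Or.inr (Or.inl ?_)
      rw [geomMult_neg_sq_of_sin_ne_zero o hμ hG (Or.inr hs), Nat.cast_ne_zero,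
        ne_eq, Submodule.finrank_eq_zero] at hz
      obtain ⟨r, hr, h1, h2⟩ := exists_real_of_ker_sub_wTransitionMatrix_ne_bot o hμ hG hz
      -- A complex `w` whose cosine lies in `[-1,1]` differs from `± arccos r` by a multiple of
      -- `2π`, so it is real.
      obtain ⟨t, rfl⟩ : ∃ t : ℝ, w = t := by
        have : Complex.cos (Real.arccos r) = Complex.cos w := by
          rw [hr, ← Complex.ofReal_cos, Real.cos_arccos h1 h2]
        obtain ⟨l, h | h⟩ := Complex.cos_eq_cos_iff.1 this
        · exact ⟨2 * l * Real.pi + Real.arccos r, by rw [h]; push_cast; rfl⟩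
        · exact ⟨2 * l * Real.pi - Real.arccos r, by rw [h]; push_cast; rfl⟩
      refine ⟨t, rfl, by exact_mod_cast hs, ?_⟩
      rw [Matrix.mem_spectrum_iff_ker_ne_bot, Complex.ofReal_cos]
      exact hz
  · rintro (rfl | ⟨t, rfl, hs, ht⟩ | ⟨k, -, -, h⟩)
    · rw [geomMult_zero o hμ hG hc]
      exact one_ne_zero
    · rw [geomMult_neg_sq_of_sin_ne_zero o hμ hG (Or.inr (by exact_mod_cast hs)), Nat.cast_ne_zero,
        ne_eq, Submodule.finrank_eq_zero]
      rw [Matrix.mem_spectrum_iff_ker_ne_bot, Complex.ofReal_cos] at ht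
      exact ht
    · exact h

end Multiplicity

theorem card_le_card_edgeSet {V : Type*} [Fintype V] (G : SimpleGraph V) [DecidableRel G.Adj]
    (hdeg : ∀ i, 2 ≤ G.degree i) : Fintype.card V ≤ Fintype.card G.edgeSet := by
  classical
  have h1 := G.sum_degrees_eq_twice_card_edges
  have h2 : Fintype.card V * 2 ≤ ∑ i, G.degree i := by
    simpa using Finset.card_nsmul_le_sum Finset.univ (fun i => G.degree i) 2 fun i _ => hdeg i
  rw [G.edgeFinset_card] at h1
  omega

theorem mainTheorem8 {V : Type*} [Fintype V] [DecidableEq V] (G : SimpleGraph V)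
    [DecidableRel G.Adj] (hconn : G.Connected) (hdeg : ∀ i, 2 ≤ G.degree i)
    (o : EdgeParam G) (c μ : G.edgeSet → ℝ) (hc : ∀ e, c e = 1) (hμ : ∀ e, 0 < μ e)
    (n m : ℕ) (hn : n = Fintype.card V) (hm : m = Fintype.card G.edgeSet)
    (A : X2 μ →ₗ.[ℂ] X2 μ) (hA : A = networkOperator o c μ)
    (P : Matrix V V ℝ) (hP : P = wTransitionMatrix G μ) :
    -- for equal weights, `P` is the transition matrix of the graph
    ((∀ e e', μ e = μ e') → P = transitionMatrix G) ∧
    -- the spectrum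
    ((G.IsBipartite ∨ m ≠ n) → UnboundedOp.spectrum A = {0} ∪ sigmaP P ∪ sigmaK) ∧
    ((¬ G.IsBipartite ∧ m = n) → UnboundedOp.spectrum A = {0} ∪ sigmaP P ∪ sigmaEven) ∧
    -- the multiplicities
    (∀ z : ℂ, UnboundedOp.algMult A z = UnboundedOp.geomMult A z) ∧
    UnboundedOp.geomMult A 0 = 1 ∧
    (∀ lam : ℝ, ((-lam : ℝ) : ℂ) ∈ sigmaP P →
      UnboundedOp.geomMult A ((-lam : ℝ) : ℂ) =
        Module.finrank ℝ (LinearMap.ker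
          (Matrix.toLin' (Real.cos (Real.sqrt lam) • (1 : Matrix V V ℝ) - P)))) ∧
    (G.IsBipartite → ∀ k : ℤ, k ≠ 0 →
      UnboundedOp.geomMult A ((-(k ^ 2 * Real.pi ^ 2) : ℝ) : ℂ) + n = m + 2) ∧
    (¬ G.IsBipartite →
      (∀ l : ℤ, l ≠ 0 →
        UnboundedOp.geomMult A ((-(4 * l ^ 2 * Real.pi ^ 2) : ℝ) : ℂ) + n = m + 2) ∧
      (∀ l : ℤ,
        UnboundedOp.geomMult A ((-((2 * l + 1) ^ 2 * Real.pi ^ 2) : ℝ) : ℂ) + n = m)) := by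
  subst hA hP
  obtain rfl : c = fun _ => 1 := funext hc
  have hG : ∀ i, ∃ k, G.Adj i k := fun i =>
    (G.degree_pos_iff_exists_adj i).1 (two_pos.trans_le (hdeg i))
  have hnm : n ≤ m := hn ▸ hm ▸ card_le_card_edgeSet G hdeg
  have even : ∀ l : ℤ, l ≠ 0 →
      UnboundedOp.geomMult (networkOperator o (fun _ => 1) μ)
        ((-(4 * l ^ 2 * Real.pi ^ 2) : ℝ) : ℂ) + n = m + 2 := by
    intro l hl
    rw [hn, hm]
    exact geomMult_even o hμ hG hconn hl
  have odd : ∀ l : ℤ, UnboundedOp.geomMult (networkOperator o (fun _ => 1) μ)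
      ((-((2 * l + 1) ^ 2 * Real.pi ^ 2) : ℝ) : ℂ) + n =
      m + (2 * Module.finrank ℂ (LinearMap.ker (o.coboundary (-1)).mulVecLin) : ℕ) := by
    intro l
    rw [hn, hm]
    exact geomMult_odd o hμ hG l
  have odd_bip : G.IsBipartite → ∀ l : ℤ,
      UnboundedOp.geomMult (networkOperator o (fun _ => 1) μ)
        ((-((2 * l + 1) ^ 2 * Real.pi ^ 2) : ℝ) : ℂ) + n = m + 2 := by
    intro hb l
    rw [odd l, o.finrank_ker_coboundary_neg_one_of_isBipartite hconn hb]
    rfl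
  have odd_nbip : ¬ G.IsBipartite → ∀ l : ℤ,
      UnboundedOp.geomMult (networkOperator o (fun _ => 1) μ)
        ((-((2 * l + 1) ^ 2 * Real.pi ^ 2) : ℝ) : ℂ) + n = m := by
    intro hb l
    rw [odd l, o.finrank_ker_coboundary_neg_one_of_not_isBipartite hconn hb]
    simp
  have sq_even : ∀ l : ℤ, (-(((l + l : ℤ) : ℝ) ^ 2 * Real.pi ^ 2) : ℝ) =
      -(4 * (l : ℝ) ^ 2 * Real.pi ^ 2) := by
    intro l
    push_cast
    ring
  have sq_odd : ∀ l : ℤ, (-(((2 * l + 1 : ℤ) : ℝ) ^ 2 * Real.pi ^ 2) : ℝ) =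
      -((2 * (l : ℝ) + 1) ^ 2 * Real.pi ^ 2) := by
    intro l
    push_cast
    ring
  -- Multiplicities are recorded additively as `x + n = q`, so positivity amounts to `n < q`.
  have ne_zero_of_lt : ∀ {x : ℕ∞} {q : ℕ}, x + n = q → n < q → x ≠ 0 := by
    rintro x q h hq rfl
    rw [zero_add, Nat.cast_inj] at h
    omega
  refine ⟨fun h => wTransitionMatrix_eq_transitionMatrix hμ hG h, fun hcase => ?_,
    fun hcase => ?_, UnboundedOp.algMult_eq_geomMult (networkOperator_isFormalAdjoint o hμ),
    geomMult_zero o hμ hG hconn, fun lam hlam => ?_, fun hb k hk => ?_,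
    fun hb => ⟨even, odd_nbip hb⟩⟩
  · ext z
    rw [mem_spectrum_iff_cases o hμ hG hconn, mem_union, mem_union, mem_singleton_iff, or_assoc]
    refine or_congr_right (or_congr_right ⟨fun ⟨k, hk, hz, _⟩ => ⟨k, hk, hz⟩, ?_⟩)
    rintro ⟨k, hk, rfl⟩
    refine ⟨k, hk, rfl, ?_⟩
    -- Even `k` has multiplicity `m - n + 2 > 0`. Odd `k` has the same in the bipartite case and
    -- otherwise `m - n`, positive because `m ≠ n`.
    rcases Int.even_or_odd' k with ⟨l, rfl | rfl⟩
    · rw [two_mul, sq_even]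
      exact ne_zero_of_lt (q := m + 2) (even l (by omega)) (by omega)
    · rw [sq_odd]
      by_cases hb : G.IsBipartite
      · exact ne_zero_of_lt (q := m + 2) (odd_bip hb l) (by omega)
      · exact ne_zero_of_lt (odd_nbip hb l) (lt_of_le_of_ne hnm (hcase.resolve_left hb).symm)
  · ext z
    rw [mem_spectrum_iff_cases o hμ hG hconn, mem_union, mem_union, mem_singleton_iff, or_assoc]
    refine or_congr_right (or_congr_right ⟨?_, ?_⟩)
    · rintro ⟨k, hk, rfl, h⟩
      rcases Int.even_or_odd' k with ⟨l, rfl | rfl⟩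
      · exact ⟨l, by omega, by rw [two_mul, sq_even]⟩
      -- For `m = n` without bipartiteness, odd `k` has multiplicity `m - n = 0`.
      · refine absurd ?_ h
        have h' := odd_nbip hcase.1 l
        rw [hcase.2] at h'
        rw [sq_odd]
        simpa using h'
    · rintro ⟨l, hl, rfl⟩
      refine ⟨l + l, by omega, by rw [sq_even], ?_⟩
      exact ne_zero_of_lt (q := m + 2) (even l hl) (by omega)
  · obtain ⟨t, ht, hs, -⟩ := (mem_sigmaP_iff o hμ hG _).1 hlam
    have hlt : lam = t ^ 2 := by
      have : (lam : ℂ) = (t : ℂ) ^ 2 := by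
        rw [Complex.ofReal_neg] at ht
        exact neg_inj.1 ht
      exact_mod_cast this
    -- Here `√lam = |t|`, and cosine is even, so the sign of `t` is immaterial.
    rw [ht, geomMult_neg_sq_ofReal o hμ hG hs, hlt, Real.sqrt_sq_eq_abs, Real.cos_abs]
  · rcases Int.even_or_odd' k with ⟨l, rfl | rfl⟩
    · rw [two_mul, sq_even]
      exact even l (by omega)
    · rw [sq_odd]
      exact odd_bip hb l
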